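/- A simple fractional hedonic game on a set $N$ of $n$ agents is given by values $v_i(j)\in\{0,1\}$ for $i\ne j$ in $N$ (with $v_i(i)=0$). A coalition is a nonempty set $S\subseteq N$, and agent $i\in S$ values it at $v_i(S)=\frac1{|S|}\sum_{j\in S}v_i(j)$. For a partition $\pi$ of $N$ let $\pi(i)$ be the block of $i$. A coalition $S$ core-blocks $\pi$ if $v_i(S)>v_i(\pi(i))$ for all $i\in S$, and $\pi$ is $\varepsilon$-fractional core-stable if $$\frac{\#\{\text{coalitions that core-block }\pi\}}{\#\{\text{coalitions}\}}<\varepsilon .$$ **Theorem.** There are two deterministic programs, a learning program $L$ and a computation program $C$ (for a random access machine with addition, truncated subtraction and unit costs), polynomials $p,q,r$ and a constant $c>0$ such that the following holds for every $n$ and every simple fractional hedonic game $v$ with $n$ agents. 1. Given $n$ and the values $v_i(j)$ of the game, $C$ returns, in at most $r(n)$ steps, a partition that is $\varepsilon$-fractional core-stable for every $\varepsilon\ge 2^{-c\,n^{1/3}}$. 2. Let $\delta\in(0,1)$, let $m\ge q(n+\log\frac1\delta)$, and let $S_1,\dots,S_m$ be independent and uniformly distributed over the subsets of $N$. The input of $L$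 consists of $n$, $m$, the sets $S_1,\dots,S_m$ and, for every $k$ and every member $i$ of $S_k$, the rational number $v_i(S_k)$. Whatever the sampled sets are, $L$ halts in at most $p(n+m)$ steps and outputs a simple fractional hedonic game $v'$ with $n$ agents, and $C$, run on $v'$, then halts in at most $r(n)$ steps and outputs a partition $\pi$. With probability at least $1-\delta$ over the samples, $v'=v$ and $\pi$ is $\varepsilon$-fractional core-stable for $v$ for every $\varepsilon\ge 2^{-c\,n^{1/3}}$. In particular, with $m=\lceil q(n+\log\frac1\delta)\rceil$ samples, the whole procedure takes time polynomial in $n$ and $\log\frac1\delta$. -/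

import Mathlib

/-! ### Simple fractional hedonic games -/

/-- A simple fractional hedonic game with agents `0, …, n - 1`: agent `i` assigns the value
`weight i j ∈ {0, 1}` to every other agent `j`, and nothing to itself. -/
structure SimpleFHG (n : ℕ) where
  weight : Fin n → Fin n → ℚ
  weight_mem : ∀ i j, weight i j = 0 ∨ weight i j = 1
  weight_self : ∀ i, weight i i = 0

namespace SimpleFHG

variable {n : ℕ}

/-- The valuation `v_i(S) = (∑_{j ∈ S} v_i(j)) / |S|`, meaningful for `i ∈ S`. -/
def value (G : SimpleFHG n) (i : Fin n) (S : Finset (Fin n)) : ℚ :=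
  (∑ j ∈ S, G.weight i j) / (S.card : ℚ)

/-- The coalition (nonempty set of agents) `S` core-blocks the partition `π`: every member of `S`
strictly prefers `S` to its own coalition in `π`. -/
def CoreBlocks (G : SimpleFHG n) (π : Finpartition (Finset.univ : Finset (Fin n)))
    (S : Finset (Fin n)) : Prop :=
  S.Nonempty ∧ ∀ i ∈ S, G.value i (π.part i) < G.value i S

/-- `π` is `ε`-fractional core-stable: the fraction of core-blocking coalitions among all
coalitions is smaller than `ε`. -/
def IsFractionalCoreStable (G : SimpleFHG n) (ε : ℝ)
    (π : Finpartition (Finset.univ : Finset (Fin n))) : Prop :=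
  ({S : Finset (Fin n) | G.CoreBlocks π S}.ncard : ℝ) /
    ({S : Finset (Fin n) | S.Nonempty}.ncard : ℝ) < ε

end SimpleFHG

/-! ### A random access machine with unit costs

Memory consists of two-dimensional arrays of natural numbers; a program names finitely many arrays.
The only arithmetic operations are addition and truncated subtraction (no multiplication), so
numbers have at most linearly many bits in the number of steps, and polynomially many
steps amount to polynomial time. -/

namespace RAM

/-- Memory contents: `σ a i j` is entry `(i, j)` of array `a`. -/
abbrev Memory := ℕ → ℕ → ℕ → ℕ

inductive Expr where
  | const (k : ℕ)
  | read (a : ℕ) (i j : Expr)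
  | add (e f : Expr)
  | sub (e f : Expr)

namespace Expr

def eval (σ : Memory) : Expr → ℕ
  | const k => k
  | read a i j => σ a (i.eval σ) (j.eval σ)
  | add e f => e.eval σ + f.eval σ
  | sub e f => e.eval σ - f.eval σ

/-- The number of elementary operations performed in the evaluation of an expression. -/
def cost : Expr → ℕ
  | const _ => 1
  | read _ i j => i.cost + j.cost + 1
  | add e f => e.cost + f.cost + 1
  | sub e f => e.cost + f.cost + 1

end Expr

inductive Program where
  | skip
  | write (a : ℕ) (i j e : Expr)
  | seq (p q : Program)
  | ite (b : Expr) (p q : Program)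
  | loop (b : Expr) (p : Program)

/-- The memory after writing `x` into entry `(i, j)` of array `a`. -/
def Memory.set (σ : Memory) (a i j x : ℕ) : Memory :=
  fun a' i' j' => if a' = a ∧ i' = i ∧ j' = j then x else σ a' i' j'

/-- `Run p σ t τ`: started on memory `σ`, the program `p` halts after exactly `t` steps with
memory `τ`. A test succeeds when its expression is nonzero; `loop b p` is `while b ≠ 0 do p`. -/
inductive Run : Program → Memory → ℕ → Memory → Prop
  | skip (σ : Memory) : Run Program.skip σ 1 σ
  | write (a : ℕ) (i j e : Expr) (σ : Memory) :
      Run (Program.write a i j e) σ (i.cost + j.cost + e.cost + 1)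
        (σ.set a (i.eval σ) (j.eval σ) (e.eval σ))
  | seq {p q : Program} {σ τ ρ : Memory} {s t : ℕ} :
      Run p σ s τ → Run q τ t ρ → Run (Program.seq p q) σ (s + t) ρ
  | ite_true {b : Expr} {p q : Program} {σ τ : Memory} {t : ℕ} :
      b.eval σ ≠ 0 → Run p σ t τ → Run (Program.ite b p q) σ (b.cost + 1 + t) τ
  | ite_false {b : Expr} {p q : Program} {σ τ : Memory} {t : ℕ} :
      b.eval σ = 0 → Run q σ t τ → Run (Program.ite b p q) σ (b.cost + 1 + t) τ
  | loop_done {b : Expr} {p : Program} {σ : Memory} :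
      b.eval σ = 0 → Run (Program.loop b p) σ (b.cost + 1) σ
  | loop_step {b : Expr} {p : Program} {σ τ ρ : Memory} {s t : ℕ} :
      b.eval σ ≠ 0 → Run p σ s τ → Run (Program.loop b p) τ t ρ →
      Run (Program.loop b p) σ (b.cost + 1 + s + t) ρ

end RAM

/-! ### Learning phase and computation phase -/

namespace SimpleFHG

variable {n : ℕ}

/-- Input of the learning phase: the numbers `n` and `m` of agents and of samples
(array `0`), and for every sampled set `S s` and every agent `i` the bit `i ∈ S s` (array `1`) and,
for the members `i` of `S s` only, numerator and denominator of the reduced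
fraction `v_i(S s)` (arrays `2` and `3`). All other entries are `0`. -/
def sampleInput (G : SimpleFHG n) {m : ℕ} (S : Fin m → Finset (Fin n)) : RAM.Memory
  | 0, 0, 0 => n
  | 0, 0, 1 => m
  | 1, s, i =>
      if h : s < m ∧ i < n then
        if (⟨i, h.2⟩ : Fin n) ∈ S ⟨s, h.1⟩ then 1 else 0
      else 0
  | 2, s, i =>
      if h : s < m ∧ i < n then
        if (⟨i, h.2⟩ : Fin n) ∈ S ⟨s, h.1⟩ then (G.value ⟨i, h.2⟩ (S ⟨s, h.1⟩)).num.toNat else 0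
      else 0
  | 3, s, i =>
      if h : s < m ∧ i < n then
        if (⟨i, h.2⟩ : Fin n) ∈ S ⟨s, h.1⟩ then (G.value ⟨i, h.2⟩ (S ⟨s, h.1⟩)).den else 0
      else 0
  | _, _, _ => 0

/-- Input of the computation phase: the number `n` of agents (array `0`) and the
matrix of the values `v_i(j)` (array `1`). All other entries are `0`. -/
def graphInput (G : SimpleFHG n) : RAM.Memory
  | 0, 0, 0 => n
  | 1, i, j => if h : i < n ∧ j < n then (G.weight ⟨i, h.1⟩ ⟨j, h.2⟩).num.toNat else 0
  | _, _, _ => 0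

/-- On the samples `S`, labelled by the valuations of `G`, the program `learn` halts within `T`
steps, and then array `4` holds the values `v_i(j)` of the game `G'`. -/
def LearnsWithin (learn : RAM.Program) (T : ℕ) (G : SimpleFHG n) {m : ℕ}
    (S : Fin m → Finset (Fin n)) (G' : SimpleFHG n) : Prop :=
  ∃ t ≤ T, ∃ τ : RAM.Memory, RAM.Run learn (G.sampleInput S) t τ ∧
    ∀ i j : Fin n, (τ 4 i j : ℚ) = G'.weight i j

/-- On the game `G`, the program `compute` halts within `T` steps, and then column `0` of array `2`
labels the agents by their coalitions in `π`. -/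
def ComputesWithin (compute : RAM.Program) (T : ℕ) (G : SimpleFHG n)
    (π : Finpartition (Finset.univ : Finset (Fin n))) : Prop :=
  ∃ t ≤ T, ∃ τ : RAM.Memory, RAM.Run compute G.graphInput t τ ∧
    ∀ i j : Fin n, τ 2 i 0 = τ 2 j 0 ↔ π.part i = π.part j

end SimpleFHG

/-- The law of `m` independent samples from the uniform distribution on the sets of agents. -/
noncomputable def uniformSamples (n m : ℕ) : PMF (Fin m → Finset (Fin n)) :=
  PMF.uniformOfFintype (Fin m → Finset (Fin n))

/-!
The theorem splits into two programs and two probabilistic estimates.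

*Programs.* All numbers that the two programs produce are values of side-effect free terms with
bounded sums (`RAM.Arith`). Such terms are compiled to the random access machine once and for all;
`RAM.Arith.run_compile` proves the compiled code correct, with a polynomial bound for its running
time that is read off the term. Programs tabulate arrays by terms (`RAM.tabulate`); a term may read
the entries that are already there, so that greedy choices can be expressed, and
`RAM.Tabulated.spec` says that the resulting recursions hold in the final memory. From there on the
arguments are about sets of agents.

*Learning.* For `i ≠ j`, the number of members of a random set `S` that `i` likes, counted as zero
for `i ∉ S` and with a minus sign for `j ∉ S`, has mean `v_i(j) / 4` (`SimpleFHG.sum_pairStat`).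
Comparing the empirical mean with `1 / 8` recovers `v_i(j)`, and Chernoff's bound (`card_sum_ge`)
makes all `n²` decisions correct with probability at least `1 - δ`.

*Computation.* Let `q` be the integral part of the cube root of `n`. Up to an exponentially small
fraction in `q`, all sets `S` are typical: their size is `n / 2` up to an error of `q² / 2`, and
they contain at most `(d + q²) / 2` of the `d` agents that `i` likes. So an agent `i` of degree `d`
whose value for its coalition is at least `(d + q²) / (n - q²)` prefers no typical coalition that it
belongs to. If `k` agents are content in this sense, then a blocking coalition is atypical or
contains none of them, which leaves a fraction of about `2⁻ᵏ`. It remains to make `k = q / 128`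
agents content (`PartitionProgram.exists_content`):

* agents of degree `0` are always content;
* `k` agents of medium degree become the centres of disjoint stars with `q` leaves each
  (`content_of_stars`);
* `k` agents of low degree are united with one liked agent for each of them, in one coalition of at
  most `2 k` members (`content_of_choice`);
* if all these classes have less than `k` members, then almost all agents like all but `O(q²)`
  others. Among them there is a clique of `k` agents, and the coalition of all agents that are liked
  by the whole clique has at least `(n + q²) / 2` members, so for the clique it beats all smaller
  coalitions (`content_of_clique`).

For small `n` the constant `c` is chosen so small that it suffices that coalitions with a
single member never block.
-/

namespace RAM

/-! ### Arithmetical terms with bounded sums, compiled to the random access machine -/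

/-- Side-effect free terms. `var v` is a loop variable, `read a e f` is the entry `(e, f)` of array
`a`, `ite c s t` is `s` if `c ≠ 0` and `t` otherwise, and `sum b v t` is the sum of `t` over all
values of the variable `v` below the entry `(0, b)` of array `0`, which is the number of agents for
`b = 0` and the number of samples for `b = 1`. -/
inductive Arith where
  | const (c : ℕ)
  | var (v : ℕ)
  | read (a : ℕ) (e f : Arith)
  | add (e f : Arith)
  | sub (e f : Arith)
  | ite (c s t : Arith)
  | sum (b v : ℕ) (t : Arith)

namespace Arith

/-- The value of a term in the memory `σ`, where `ρ` holds the values of the loop variables. -/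
def eval (σ : Memory) : Arith → (ℕ → ℕ) → ℕ
  | const c, _ => c
  | var v, ρ => ρ v
  | read a e f, ρ => σ a (e.eval σ ρ) (f.eval σ ρ)
  | add e f, ρ => e.eval σ ρ + f.eval σ ρ
  | sub e f, ρ => e.eval σ ρ - f.eval σ ρ
  | ite c s t, ρ => if c.eval σ ρ = 0 then t.eval σ ρ else s.eval σ ρ
  | sum b v t, ρ => ∑ k ∈ Finset.range (σ 0 0 b), t.eval σ (Function.update ρ v k)

/-- Well-formedness of a term in the scope of the loop variables `0, …, d - 1`: sums bind the next
variable, only the arrays `0, …, 19` are read (the compiled code uses the arrays `20` and `21` as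
its work space), and all sums have one of the two admissible bounds. -/
def wf : ℕ → Arith → Bool
  | _, const _ => true
  | d, var v => decide (v < d)
  | d, read a e f => decide (a < 20) && (wf d e && wf d f)
  | d, add e f => wf d e && wf d f
  | d, sub e f => wf d e && wf d f
  | d, ite c s t => wf d c && (wf d s && wf d t)
  | d, sum b v t => (decide (b < 2) && decide (v = d)) && wf (d + 1) t

end Arith

/-- `for v < (entry (0, b) of array 0) do p`; the variable `v` lives in entry `(v, 0)` of
array `20`. -/
def forLoop (b v : ℕ) (p : Program) : Program :=
  .seq (.write 20 (.const v) (.const 0) (.const 0))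
    (.loop (.sub (.read 0 (.const 0) (.const b)) (.read 20 (.const v) (.const 0)))
      (.seq p (.write 20 (.const v) (.const 0)
        (.add (.read 20 (.const v) (.const 0)) (.const 1)))))

/-- The stack cell `s`, where the compiled code leaves intermediate results. -/
def stackCell (s : ℕ) : Expr := .read 21 (.const s) (.const 0)

/-- The assignment of `e` to the stack cell `s`. -/
def toStack (s : ℕ) (e : Expr) : Program := .write 21 (.const s) (.const 0) e

namespace Arith

/-- Code that evaluates a term and leaves its value in the stack cell `s`. -/
def compile : ℕ → Arith → Program
  | s, const c => toStack s (.const c)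
  | s, var v => toStack s (.read 20 (.const v) (.const 0))
  | s, read a e f => .seq (.seq (compile s e) (compile (s + 1) f))
      (toStack s (.read a (stackCell s) (stackCell (s + 1))))
  | s, add e f => .seq (.seq (compile s e) (compile (s + 1) f))
      (toStack s (.add (stackCell s) (stackCell (s + 1))))
  | s, sub e f => .seq (.seq (compile s e) (compile (s + 1) f))
      (toStack s (.sub (stackCell s) (stackCell (s + 1))))
  | s, ite c e f => .seq (compile s c) (.ite (stackCell s) (compile s e) (compile s f))
  | s, sum b v t => .seq (toStack s (.const 0)) (forLoop b v
      (.seq (compile (s + 1) t) (toStack s (.add (stackCell s) (stackCell (s + 1))))))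

open Polynomial in
/-- A bound for the running time of the compiled code, as a polynomial in a bound for all loops. -/
noncomputable def cost : Arith → Polynomial ℕ
  | const _ => 4
  | var _ => 6
  | read _ e f => e.cost + f.cost + 10
  | add e f => e.cost + f.cost + 10
  | sub e f => e.cost + f.cost + 10
  | ite c e f => c.cost + (e.cost + f.cost) + 4
  | sum _ _ t => (X + 1) * (t.cost + 26) + 4

end Arith

/-- A computation from `σ` to `τ` that keeps the user arrays, the loop variables below `d` and the
stack cells below `s`. -/
structure Agree (d s : ℕ) (σ τ : Memory) : Prop where
  user : ∀ a < 20, τ a = σ a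
  vars : ∀ u < d, τ 20 u 0 = σ 20 u 0
  stack : ∀ r < s, τ 21 r 0 = σ 21 r 0

theorem Agree.trans {d s d' s' : ℕ} {σ τ υ : Memory} (h : Agree d s σ τ) (h' : Agree d' s' τ υ)
    (hd : d ≤ d') (hs : s ≤ s') : Agree d s σ υ :=
  ⟨fun a ha => (h'.user a ha).trans (h.user a ha),
    fun u hu => (h'.vars u (hu.trans_le hd)).trans (h.vars u hu),
    fun r hr => (h'.stack r (hr.trans_le hs)).trans (h.stack r hr)⟩

theorem Memory.set_apply (σ : Memory) (a i j x a' i' j' : ℕ) :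
    σ.set a i j x a' i' j' = if a' = a ∧ i' = i ∧ j' = j then x else σ a' i' j' := rfl

theorem Memory.set_of_ne (σ : Memory) {a a' : ℕ} (h : a' ≠ a) (i j x : ℕ) :
    σ.set a i j x a' = σ a' := by
  funext i' j'
  simp [Memory.set_apply, h]

theorem agree_set_stack (d s x : ℕ) (σ : Memory) : Agree d s σ (σ.set 21 s 0 x) where
  user a ha := Memory.set_of_ne _ (by omega) _ _ _
  vars u _ := by rw [Memory.set_of_ne _ (by omega)]
  stack r hr := by
    rw [Memory.set_apply, if_neg]
    omega

theorem agree_set_var (d s x : ℕ) (σ : Memory) : Agree d s σ (σ.set 20 d 0 x) where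
  user a ha := Memory.set_of_ne _ (by omega) _ _ _
  vars u hu := by
    rw [Memory.set_apply, if_neg]
    omega
  stack r _ := by rw [Memory.set_of_ne _ (by omega)]

/-- The rule for `for` loops: an invariant that is established by `v := 0` and passed on by each
round of the loop holds at the end. -/
theorem run_forLoop {b v C : ℕ} {p : Program} {σ : Memory} (Inv : ℕ → Memory → Prop)
    (hv : ∀ i τ, Inv i τ → τ 20 v 0 = i) (hb : ∀ i τ, Inv i τ → τ 0 0 b = σ 0 0 b)
    (h0 : Inv 0 (σ.set 20 v 0 0))
    (hstep : ∀ i < σ 0 0 b, ∀ τ, Inv i τ → ∃ T τ', T ≤ C ∧ Run p τ T τ' ∧ τ' 20 v 0 = i ∧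
      Inv (i + 1) (τ'.set 20 v 0 (i + 1))) :
    ∃ T τ, T ≤ (σ 0 0 b + 1) * (C + 16) ∧ Run (forLoop b v p) σ T τ ∧ Inv (σ 0 0 b) τ := by
  -- Induction on the number `r` of rounds that are still to come.
  have key : ∀ r i τ, i + r = σ 0 0 b → Inv i τ → ∃ T τ', T ≤ r * (C + 16) + 8 ∧
      Run (.loop (.sub (.read 0 (.const 0) (.const b)) (.read 20 (.const v) (.const 0)))
      (.seq p (.write 20 (.const v) (.const 0)
        (.add (.read 20 (.const v) (.const 0)) (.const 1))))) τ T τ' ∧ Inv (σ 0 0 b) τ' := by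
    intro r
    induction r with
    | zero =>
      intro i τ hi hI
      refine ⟨_, τ, ?_, Run.loop_done ?_, ?_⟩
      · simp [Expr.cost]
      · simp only [Expr.eval, hv i τ hI, hb i τ hI]
        omega
      · have : i = σ 0 0 b := by omega
        rwa [this] at hI
    | succ r ih =>
      intro i τ hi hI
      obtain ⟨T, τ', hT, hrun, hvar, hI'⟩ := hstep i (by omega) τ hI
      obtain ⟨T', τ'', hT', hrun', hI''⟩ := ih (i + 1) _ (by omega) hI'
      have hw := Run.write 20 (.const v) (.const 0)
        (.add (.read 20 (.const v) (.const 0)) (.const 1)) τ'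
      simp only [Expr.eval, hvar] at hw
      refine ⟨_, τ'', ?_, Run.loop_step ?_ (Run.seq hrun hw) hrun', hI''⟩
      · simp only [Expr.cost]
        nlinarith
      · simp only [Expr.eval, hv i τ hI, hb i τ hI]
        omega
  obtain ⟨T, τ, hT, hrun, hI⟩ := key (σ 0 0 b) 0 _ (by omega) h0
  refine ⟨_, τ, ?_, Run.seq (Run.write ..) hrun, hI⟩
  simp only [Expr.cost]
  nlinarith

namespace Arith

/-- The value of a well-formed term depends on the user arrays and the variables in scope only. -/
theorem eval_congr {σ τ : Memory} (h : ∀ a < 20, σ a = τ a) (t : Arith) :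
    ∀ (d : ℕ) (ρ ρ' : ℕ → ℕ), t.wf d = true → (∀ u < d, ρ u = ρ' u) →
      t.eval σ ρ = t.eval τ ρ' := by
  induction t with
  | const c => intros; rfl
  | var v =>
    intro d ρ ρ' hw hρ
    exact hρ v (by simpa [wf] using hw)
  | read a e f he hf =>
    intro d ρ ρ' hw hρ
    simp only [wf, Bool.and_eq_true, decide_eq_true_eq] at hw
    simp only [eval, h a hw.1, he d ρ ρ' hw.2.1 hρ, hf d ρ ρ' hw.2.2 hρ]
  | add e f he hf =>
    intro d ρ ρ' hw hρ
    simp only [wf, Bool.and_eq_true] at hw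
    simp only [eval, he d ρ ρ' hw.1 hρ, hf d ρ ρ' hw.2 hρ]
  | sub e f he hf =>
    intro d ρ ρ' hw hρ
    simp only [wf, Bool.and_eq_true] at hw
    simp only [eval, he d ρ ρ' hw.1 hρ, hf d ρ ρ' hw.2 hρ]
  | ite c e f hc he hf =>
    intro d ρ ρ' hw hρ
    simp only [wf, Bool.and_eq_true] at hw
    simp only [eval, hc d ρ ρ' hw.1 hρ, he d ρ ρ' hw.2.1 hρ, hf d ρ ρ' hw.2.2 hρ]
  | sum b v t ht =>
    intro d ρ ρ' hw hρ
    simp only [wf, Bool.and_eq_true, decide_eq_true_eq] at hw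
    simp only [eval, h 0 (by omega)]
    refine Finset.sum_congr rfl fun k _ => ht (d + 1) _ _ hw.2 fun u hu => ?_
    by_cases huv : u = v
    · simp [huv]
    · simp [huv, hρ u (by omega)]

/-- Binary operations: both operands are evaluated to neighbouring stack cells, then combined. -/
theorem run_binary {e f : Arith} {x : Expr} {d s N : ℕ} {σ : Memory} {ρ : ℕ → ℕ} {val : ℕ}
    {Te Tf τe τf} (he : Te ≤ e.cost.eval N ∧ Run (e.compile s) σ Te τe ∧
      Agree d s σ τe ∧ τe 21 s 0 = e.eval σ ρ)
    (hf : Tf ≤ f.cost.eval N ∧ Run (f.compile (s + 1)) τe Tf τf ∧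
      Agree d (s + 1) τe τf ∧ τf 21 (s + 1) 0 = f.eval σ ρ)
    (hx : x.cost = 7)
    (hval : ∀ τ : Memory, (∀ a < 20, τ a = σ a) → τ 21 s 0 = e.eval σ ρ →
      τ 21 (s + 1) 0 = f.eval σ ρ → x.eval τ = val) :
    ∃ T τ, T ≤ e.cost.eval N + f.cost.eval N + 10 ∧
      Run (.seq (.seq (e.compile s) (f.compile (s + 1))) (toStack s x)) σ T τ ∧
      Agree d s σ τ ∧ τ 21 s 0 = val := by
  obtain ⟨he1, he2, he3, he4⟩ := he
  obtain ⟨hf1, hf2, hf3, hf4⟩ := hf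
  have hA := he3.trans hf3 le_rfl (Nat.le_succ s)
  refine ⟨_, _, ?_, Run.seq (Run.seq he2 hf2) (Run.write ..),
    hA.trans (agree_set_stack d s _ _) le_rfl le_rfl, ?_⟩
  · simp only [Expr.cost, hx]
    omega
  · simp only [Expr.eval, Memory.set_apply, and_self, if_true]
    exact hval _ hA.user ((hf3.stack s (by omega)).trans he4) hf4

/-- The compiled code of a term is correct and obeys its time bound. -/
theorem run_compile (t : Arith) : ∀ (d s N : ℕ) (σ : Memory) (ρ : ℕ → ℕ), t.wf d = true →
    (∀ u < d, σ 20 u 0 = ρ u) → σ 0 0 0 + σ 0 0 1 ≤ N →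
    ∃ T τ, T ≤ t.cost.eval N ∧ Run (t.compile s) σ T τ ∧ Agree d s σ τ ∧
      τ 21 s 0 = t.eval σ ρ := by
  have binary : ∀ (e f : Arith), (∀ (d s N : ℕ) (σ : Memory) (ρ : ℕ → ℕ), e.wf d = true →
      (∀ u < d, σ 20 u 0 = ρ u) → σ 0 0 0 + σ 0 0 1 ≤ N →
      ∃ T τ, T ≤ e.cost.eval N ∧ Run (e.compile s) σ T τ ∧ Agree d s σ τ ∧
        τ 21 s 0 = e.eval σ ρ) → (∀ (d s N : ℕ) (σ : Memory) (ρ : ℕ → ℕ), f.wf d = true →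
      (∀ u < d, σ 20 u 0 = ρ u) → σ 0 0 0 + σ 0 0 1 ≤ N →
      ∃ T τ, T ≤ f.cost.eval N ∧ Run (f.compile s) σ T τ ∧ Agree d s σ τ ∧
        τ 21 s 0 = f.eval σ ρ) →
      ∀ (d s N : ℕ) (σ : Memory) (ρ : ℕ → ℕ) (x : Expr) (val : ℕ),
      e.wf d = true → f.wf d = true → (∀ u < d, σ 20 u 0 = ρ u) → σ 0 0 0 + σ 0 0 1 ≤ N →
      x.cost = 7 → (∀ τ : Memory, (∀ a < 20, τ a = σ a) → τ 21 s 0 = e.eval σ ρ →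
        τ 21 (s + 1) 0 = f.eval σ ρ → x.eval τ = val) →
      ∃ T τ, T ≤ e.cost.eval N + f.cost.eval N + 10 ∧
        Run (.seq (.seq (e.compile s) (f.compile (s + 1))) (toStack s x)) σ T τ ∧
        Agree d s σ τ ∧ τ 21 s 0 = val := by
    intro e f he hf d s N σ ρ x val hwe hwf hρ hN hx hval
    obtain ⟨Te, τe, he'⟩ := he d s N σ ρ hwe hρ hN
    have hA := he'.2.2.1
    obtain ⟨Tf, τf, hf1, hf2, hf3, hf4⟩ := hf d (s + 1) N τe ρ hwf
      (fun u hu => (hA.vars u hu).trans (hρ u hu)) (by rwa [hA.user 0 (by omega)])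
    rw [eval_congr hA.user f d ρ ρ hwf fun _ _ => rfl] at hf4
    exact run_binary he' ⟨hf1, hf2, hf3, hf4⟩ hx hval
  induction t with
  | const c =>
    intro d s N σ ρ hw hρ hN
    refine ⟨_, _, ?_, Run.write .., agree_set_stack d s _ _, ?_⟩
    · simp [Expr.cost, cost]
    · simp [Expr.eval, Memory.set_apply, eval]
  | var v =>
    intro d s N σ ρ hw hρ hN
    refine ⟨_, _, ?_, Run.write .., agree_set_stack d s _ _, ?_⟩
    · simp [Expr.cost, cost]
    · simp only [Expr.eval, Memory.set_apply, eval, and_self, if_true]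
      exact hρ v (by simpa [wf] using hw)
  | read a e f he hf =>
    intro d s N σ ρ hw hρ hN
    simp only [wf, Bool.and_eq_true, decide_eq_true_eq] at hw
    have := binary e f he hf d s N σ ρ (.read a (stackCell s) (stackCell (s + 1)))
      ((read a e f).eval σ ρ) hw.2.1 hw.2.2 hρ hN rfl (by
        intro τ hu h1 h2
        simp [stackCell, Expr.eval, eval, h1, h2, hu a hw.1])
    simpa [cost, compile] using this
  | add e f he hf =>
    intro d s N σ ρ hw hρ hN
    simp only [wf, Bool.and_eq_true] at hw
    have := binary e f he hf d s N σ ρ (.add (stackCell s) (stackCell (s + 1)))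
      ((add e f).eval σ ρ) hw.1 hw.2 hρ hN rfl (by
        intro τ hu h1 h2
        simp [stackCell, Expr.eval, eval, h1, h2])
    simpa [cost, compile] using this
  | sub e f he hf =>
    intro d s N σ ρ hw hρ hN
    simp only [wf, Bool.and_eq_true] at hw
    have := binary e f he hf d s N σ ρ (.sub (stackCell s) (stackCell (s + 1)))
      ((sub e f).eval σ ρ) hw.1 hw.2 hρ hN rfl (by
        intro τ hu h1 h2
        simp [stackCell, Expr.eval, eval, h1, h2])
    simpa [cost, compile] using this
  | ite c e f hc he hf =>
    intro d s N σ ρ hw hρ hN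
    simp only [wf, Bool.and_eq_true] at hw
    obtain ⟨T, τ, h1, h2, h3, h4⟩ := hc d s N σ ρ hw.1 hρ hN
    have hρ' : ∀ u < d, τ 20 u 0 = ρ u := fun u hu => (h3.vars u hu).trans (hρ u hu)
    have hN' : τ 0 0 0 + τ 0 0 1 ≤ N := by rwa [h3.user 0 (by omega)]
    by_cases hz : c.eval σ ρ = 0
    · obtain ⟨T', τ', h1', h2', h3', h4'⟩ := hf d s N τ ρ hw.2.2 hρ' hN'
      refine ⟨_, τ', ?_, Run.seq h2 (Run.ite_false (by simpa [stackCell, Expr.eval, h4]) h2'),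
        h3.trans h3' le_rfl le_rfl, ?_⟩
      · simp only [stackCell, Expr.cost, cost, Polynomial.eval_add, Polynomial.eval_ofNat]
        omega
      · rw [h4', eval_congr h3.user f d ρ ρ hw.2.2 fun _ _ => rfl]
        simp [eval, hz]
    · obtain ⟨T', τ', h1', h2', h3', h4'⟩ := he d s N τ ρ hw.2.1 hρ' hN'
      refine ⟨_, τ', ?_, Run.seq h2 (Run.ite_true (by simpa [stackCell, Expr.eval, h4]) h2'),
        h3.trans h3' le_rfl le_rfl, ?_⟩
      · simp only [stackCell, Expr.cost, cost, Polynomial.eval_add, Polynomial.eval_ofNat]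
        omega
      · rw [h4', eval_congr h3.user e d ρ ρ hw.2.1 fun _ _ => rfl]
        simp [eval, hz]
  | sum b v t ht =>
    intro d s N σ ρ hw hρ hN
    simp only [wf, Bool.and_eq_true, decide_eq_true_eq] at hw
    obtain ⟨⟨hb, rfl⟩, hw⟩ := hw
    have hbN : σ 0 0 b ≤ N := by
      interval_cases b <;> omega
    obtain ⟨T, τ, hT, hrun, hI1, hI2, hI3⟩ := run_forLoop (b := b) (v := v)
      (C := t.cost.eval N + 10)
      (p := .seq (t.compile (s + 1)) (toStack s (.add (stackCell s) (stackCell (s + 1)))))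
      (σ := σ.set 21 s 0 0)
      (fun i τ => Agree v s σ τ ∧ τ 20 v 0 = i ∧
        τ 21 s 0 = ∑ k ∈ Finset.range i, t.eval σ (Function.update ρ v k))
      (fun i τ h => h.2.1)
      (fun i τ h => by rw [h.1.user 0 (by omega), Memory.set_of_ne _ (by omega)])
      ⟨(agree_set_stack v s 0 σ).trans (agree_set_var v s 0 _) le_rfl le_rfl,
        by simp [Memory.set_apply], by simp [Memory.set_apply]⟩ (by
      rintro i - τ ⟨hA, hv, hs⟩
      have hρ' : ∀ u < v + 1, τ 20 u 0 = Function.update ρ v i u := by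
        intro u hu
        by_cases huv : u = v
        · simp [huv, hv]
        · rw [hA.vars u (by omega), hρ u (by omega)]
          simp [huv]
      obtain ⟨T, τ', h1, h2, h3, h4⟩ := ht (v + 1) (s + 1) N τ (Function.update ρ v i) hw hρ'
        (by rwa [hA.user 0 (by omega)])
      have hA' := hA.trans h3 (Nat.le_succ v) (Nat.le_succ s)
      refine ⟨_, _, ?_, Run.seq h2 (Run.write ..), ?_, ?_, ?_, ?_⟩
      · simp only [stackCell, Expr.cost]
        omega
      · rw [Memory.set_of_ne _ (by omega), h3.vars v (by omega), hv]
      · exact (hA'.trans (agree_set_stack v s _ _) le_rfl le_rfl).trans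
          (agree_set_var v s _ _) le_rfl le_rfl
      · simp [Memory.set_apply]
      · rw [Memory.set_of_ne _ (by omega), Finset.sum_range_succ]
        simp only [Memory.set_apply, Expr.eval, stackCell, and_self, if_true]
        rw [h4, h3.stack s (by omega), hs, eval_congr hA.user t _ _ _ hw fun _ _ => rfl])
    have hB : (σ.set 21 s 0 0) 0 0 b = σ 0 0 b := by rw [Memory.set_of_ne _ (by omega)]
    rw [hB] at hT hI2 hI3
    refine ⟨_, τ, ?_, Run.seq (Run.write ..) hrun, hI1, hI3⟩
    simp only [Expr.cost, cost, Polynomial.eval_add, Polynomial.eval_mul, Polynomial.eval_X,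
      Polynomial.eval_one, Polynomial.eval_ofNat]
    have : (σ 0 0 b + 1) * (t.cost.eval N + 10 + 16) ≤ (N + 1) * (t.cost.eval N + 26) := by
      gcongr
    omega

end Arith
end RAM

namespace RAM

/-! ### Tabulation of arrays -/

/-- The assignment of the values `i`, `j` to the loop variables `0`, `1`. -/
def env (i j : ℕ) : ℕ → ℕ := fun v => if v = 0 then i else j

/-- `for i < n do for j < n do A (i, j) := t`, where `t` may use the loop variables `0` (for `i`)
and `1` (for `j`) and may read the entries of `A` that have already been written. -/
def tabulate (A : ℕ) (t : Arith) : Program :=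
  forLoop 0 0 (forLoop 0 1 (.seq (t.compile 0)
    (.write A (.read 20 (.const 0) (.const 0)) (.read 20 (.const 1) (.const 0)) (stackCell 0))))

open Polynomial in
/-- A bound for the running time of a tabulation. -/
noncomputable def tabulateCost (t : Arith) : Polynomial ℕ :=
  (X + 1) * ((X + 1) * (t.cost + 30) + 16)

/-- The memory after `j` steps of the inner loop, in row `i`. -/
def fillRow (A : ℕ) (t : Arith) (i : ℕ) (σ : Memory) : ℕ → Memory
  | 0 => σ
  | j + 1 => (fillRow A t i σ j).set A i j (t.eval (fillRow A t i σ j) (env i j))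

/-- The memory after `i` rounds of the outer loop, each with `n` rounds of the inner loop. -/
def fill (A : ℕ) (t : Arith) (n : ℕ) (σ : Memory) : ℕ → Memory
  | 0 => σ
  | i + 1 => fillRow A t i (fill A t n σ i) n

theorem fillRow_of_ne {A a : ℕ} (h : a ≠ A) (t : Arith) (i : ℕ) (σ : Memory) (j : ℕ) :
    fillRow A t i σ j a = σ a := by
  induction j with
  | zero => rfl
  | succ j ih => rw [fillRow, Memory.set_of_ne _ h, ih]

theorem fill_of_ne {A a : ℕ} (h : a ≠ A) (t : Arith) (n : ℕ) (σ : Memory) (i : ℕ) :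
    fill A t n σ i a = σ a := by
  induction i with
  | zero => rfl
  | succ i ih => rw [fill, fillRow_of_ne h, ih]

/-- Row `i` changes only in the entries written so far. -/
theorem fillRow_of_not_lt {A i i' j j' : ℕ} (t : Arith) (σ : Memory) (h : ¬ (i' = i ∧ j' < j)) :
    fillRow A t i σ j A i' j' = σ A i' j' := by
  induction j with
  | zero => rfl
  | succ j ih =>
    rw [fillRow, Memory.set_apply, if_neg (by omega), ih (by omega)]

/-- An entry keeps its value once it has been written. -/
theorem fillRow_of_lt {A i j j' : ℕ} (t : Arith) (σ : Memory) (h : j' < j) :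
    fillRow A t i σ j A i j' = t.eval (fillRow A t i σ j') (env i j') := by
  induction j with
  | zero => omega
  | succ j ih =>
    rw [fillRow, Memory.set_apply]
    by_cases hj : j' = j
    · simp [hj]
    · rw [if_neg (by omega), ih (by omega)]

theorem fill_of_le {A n i i' : ℕ} (t : Arith) (σ : Memory) (h : i ≤ i') (j : ℕ) :
    fill A t n σ i A i' j = σ A i' j := by
  induction i with
  | zero => rfl
  | succ i ih => rw [fill, fillRow_of_not_lt _ _ (by omega), ih (by omega)]

theorem fill_of_lt {A n i i' : ℕ} (t : Arith) (σ : Memory) (h : i' < i) (j : ℕ) :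
    fill A t n σ i A i' j = fill A t n σ (i' + 1) A i' j := by
  induction i with
  | zero => omega
  | succ i ih =>
    by_cases hi : i' = i
    · rw [hi]
    · rw [fill, fillRow_of_not_lt _ _ (by omega), ih (by omega)]

/-- The memory at the time when entry `(i, j)` of the array `A` is written, in terms of the memory
`σ` before and `τ` after the tabulation. -/
def partialMemory (A : ℕ) (σ τ : Memory) (i j : ℕ) : Memory := fun a i' j' =>
  if a = A ∧ ¬ (i' < i ∨ i' = i ∧ j' < j) then σ a i' j' else τ a i' j'

theorem fill_eq_eval {A n : ℕ} (t : Arith) (σ : Memory) {i j : ℕ} (hi : i < n) (hj : j < n) :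
    fill A t n σ n A i j =
      t.eval (partialMemory A σ (fill A t n σ n) i j) (env i j) := by
  rw [fill_of_lt t σ hi, fill, fillRow_of_lt _ _ hj]
  congr 1
  funext a i' j'
  rw [partialMemory]
  by_cases ha : a = A
  · subst ha
    by_cases hlt : i' < i ∨ i' = i ∧ j' < j
    · simp only [true_and, hlt, not_true_eq_false, if_false]
      rcases hlt with h | ⟨rfl, h⟩
      · rw [fillRow_of_not_lt _ _ (by omega), fill_of_lt t σ h, fill_of_lt t σ (h.trans hi)]
      · rw [fillRow_of_lt _ _ h, fill_of_lt t σ hi, fill, fillRow_of_lt _ _ (h.trans hj)]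
    · simp only [true_and, hlt, not_false_eq_true, if_true]
      rw [fillRow_of_not_lt _ _ (by omega), fill_of_le _ _ (by omega)]
  · rw [if_neg (by tauto), fillRow_of_ne ha, fill_of_ne ha, fill_of_ne ha]

theorem env_zero (i j : ℕ) : env i j 0 = i := rfl
theorem env_one (i j : ℕ) : env i j 1 = j := rfl

/-- Tabulation is correct: it keeps all other user arrays, and the new entries satisfy the
recursion expressed by the term. -/
theorem run_tabulate {A : ℕ} {t : Arith} (hA : A < 20) (hA0 : A ≠ 0) (hw : t.wf 2 = true)
    (σ : Memory) {N : ℕ} (hN : σ 0 0 0 + σ 0 0 1 ≤ N) :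
    ∃ T τ, T ≤ (tabulateCost t).eval N ∧ Run (tabulate A t) σ T τ ∧
      (∀ a < 20, a ≠ A → τ a = σ a) ∧
      ∀ i < σ 0 0 0, ∀ j < σ 0 0 0,
        τ A i j = t.eval (partialMemory A σ τ i j) (env i j) := by
  set n := σ 0 0 0 with hn
  have hfill0 : ∀ i, fill A t n σ i 0 = σ 0 := fun i => fill_of_ne hA0.symm _ _ _ _
  obtain ⟨T, τ, hT, hrun, hI, -⟩ := run_forLoop (b := 0) (v := 0)
    (C := (n + 1) * (t.cost.eval N + 14 + 16))
    (p := forLoop 0 1 (.seq (t.compile 0) (.write A (.read 20 (.const 0) (.const 0))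
      (.read 20 (.const 1) (.const 0)) (stackCell 0)))) (σ := σ)
    (fun i τ => (∀ a < 20, τ a = fill A t n σ i a) ∧ τ 20 0 0 = i)
    (fun i τ h => h.2) (fun i τ h => by rw [h.1 0 (by omega), hfill0])
    ⟨fun a ha => Memory.set_of_ne _ (by omega) _ _ _, by simp [Memory.set_apply]⟩ (by
    rintro i - τ ⟨hu, hv⟩
    have hτ0 : τ 0 = σ 0 := by rw [hu 0 (by omega), hfill0]
    obtain ⟨T, τ', hT, hrun, hI1, hI2, hI3⟩ := run_forLoop (b := 0) (v := 1)
      (C := t.cost.eval N + 14)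
      (p := .seq (t.compile 0) (.write A (.read 20 (.const 0) (.const 0))
        (.read 20 (.const 1) (.const 0)) (stackCell 0))) (σ := τ)
      (fun j υ => (∀ a < 20, υ a = fillRow A t i (fill A t n σ i) j a) ∧
        υ 20 0 0 = i ∧ υ 20 1 0 = j)
      (fun j υ h => h.2.2)
      (fun j υ h => by rw [h.1 0 (by omega), fillRow_of_ne hA0.symm, hfill0, hτ0])
      ⟨fun a ha => (Memory.set_of_ne _ (by omega) _ _ _).trans (hu a ha),
        by simp [Memory.set_apply, hv], by simp [Memory.set_apply]⟩ (by
      rintro j - υ ⟨hu', hv0, hv1⟩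
      have hυ0 : υ 0 = σ 0 := by rw [hu' 0 (by omega), fillRow_of_ne hA0.symm, hfill0]
      obtain ⟨T, τ', h1, h2, h3, h4⟩ := t.run_compile 2 0 N υ (env i j) hw (by
        intro u hu
        interval_cases u
        · exact hv0
        · exact hv1) (by rwa [hυ0])
      rw [Arith.eval_congr hu' t 2 _ _ hw fun _ _ => rfl] at h4
      have e0 := (h3.vars 0 (by omega)).trans hv0
      have e1 := (h3.vars 1 (by omega)).trans hv1
      have hne : (20 : ℕ) ≠ A := by omega
      refine ⟨_, _, ?_, Run.seq h2 (Run.write ..), ?_, ?_, ?_, ?_⟩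
      · simp only [stackCell, Expr.cost]
        omega
      · rw [Memory.set_of_ne _ hne, e1]
      · intro a ha
        rw [Memory.set_of_ne _ (by omega)]
        funext i' j'
        simp only [fillRow, Memory.set_apply, Expr.eval, stackCell, e0, e1, h4, h3.user a ha,
          hu' a ha]
      · rw [Memory.set_apply, if_neg (by omega), Memory.set_of_ne _ hne, e0]
      · simp [Memory.set_apply])
    rw [hτ0, ← hn] at hT hI1 hI3
    refine ⟨T, τ', hT, hrun, hI2, ?_, by simp [Memory.set_apply]⟩
    intro a ha
    rw [Memory.set_of_ne _ (by omega), hI1 a ha, fill])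
  rw [← hn] at hT hI
  refine ⟨T, τ, hT.trans ?_, hrun, fun a ha h => (hI a ha).trans (fill_of_ne h _ _ _ _), ?_⟩
  · have hnN : n ≤ N := by omega
    simp only [tabulateCost, Polynomial.eval_add, Polynomial.eval_mul, Polynomial.eval_X,
      Polynomial.eval_one, Polynomial.eval_ofNat]
    rw [show t.cost.eval N + 30 = t.cost.eval N + 14 + 16 from rfl]
    gcongr
  · intro i hi j hj
    rw [hI A hA, fill_eq_eval t σ hi hj]
    refine Arith.eval_congr (fun a ha => ?_) t 2 _ _ hw fun _ _ => rfl
    funext i' j'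
    simp only [partialMemory, hI a ha]

/-! ### Sequences of tabulations -/

/-- The tabulation of several arrays, one after the other. -/
def tabulateAll : List (ℕ × Arith) → Program
  | [] => .skip
  | (A, t) :: l => .seq (tabulate A t) (tabulateAll l)

open Polynomial in
/-- A bound for the running time of a sequence of tabulations. -/
noncomputable def tabulateAllCost : List (ℕ × Arith) → Polynomial ℕ
  | [] => 1
  | (_, t) :: l => tabulateCost t + tabulateAllCost l

/-- The relation between the memories before and after a sequence of tabulations of arrays of
side length `n`. -/
def Tabulated (n : ℕ) : Memory → List (ℕ × Arith) → Memory → Prop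
  | σ, [], τ => τ = σ
  | σ, (A, t) :: l, τ => ∃ υ : Memory, ((∀ a < 20, a ≠ A → υ a = σ a) ∧
      ∀ i < n, ∀ j < n, υ A i j = t.eval (partialMemory A σ υ i j) (env i j)) ∧
      Tabulated n υ l τ

theorem run_tabulateAll (l : List (ℕ × Arith))
    (hl : l.all (fun x => decide (x.1 < 20 ∧ x.1 ≠ 0) && x.2.wf 2) = true) :
    ∀ (σ : Memory) (N : ℕ), σ 0 0 0 + σ 0 0 1 ≤ N →
    ∃ T τ, T ≤ (tabulateAllCost l).eval N ∧ Run (tabulateAll l) σ T τ ∧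
      Tabulated (σ 0 0 0) σ l τ := by
  induction l with
  | nil => exact fun σ N _ => ⟨1, σ, by simp [tabulateAllCost], Run.skip σ, rfl⟩
  | cons x l ih =>
    obtain ⟨A, t⟩ := x
    intro σ N hN
    simp only [List.all_cons, Bool.and_eq_true, decide_eq_true_eq] at hl
    obtain ⟨⟨⟨hA, hA0⟩, hw⟩, hl⟩ := hl
    obtain ⟨T, υ, hT, hrun, hu, hval⟩ := run_tabulate hA hA0 hw σ hN
    have h0 : υ 0 = σ 0 := hu 0 (by omega) hA0.symm
    obtain ⟨T', τ, hT', hrun', hτ⟩ := ih hl υ N (by rwa [h0])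
    rw [h0] at hτ
    refine ⟨T + T', τ, ?_, Run.seq hrun hrun', υ, ⟨hu, hval⟩, hτ⟩
    simp only [tabulateAllCost, Polynomial.eval_add]
    omega

end RAM

namespace RAM
namespace Arith

/-! ### Logical terms -/

/-- A term, read as a truth value. -/
def Holds (σ : Memory) (ρ : ℕ → ℕ) (t : Arith) : Prop := t.eval σ ρ ≠ 0

instance (σ : Memory) (ρ : ℕ → ℕ) (t : Arith) : Decidable (t.Holds σ ρ) :=
  inferInstanceAs (Decidable (_ ≠ _))

/-- The comparison `e < f`, by truncated subtraction. -/
def lt (e f : Arith) : Arith := sub f e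
def not (e : Arith) : Arith := ite e (const 0) (const 1)
def le (e f : Arith) : Arith := not (lt f e)
def and (e f : Arith) : Arith := ite e f (const 0)
def or (e f : Arith) : Arith := ite e (const 1) f
def eq (e f : Arith) : Arith := and (le e f) (le f e)

/-- The number of agents `v` for which `t` holds. -/
def count (v : ℕ) (t : Arith) : Arith := sum 0 v (ite t (const 1) (const 0))

/-- There is an agent `v` for which `t` holds. -/
def ex (v : ℕ) (t : Arith) : Arith := count v t

/-- All agents `v` satisfy `t`. -/
def all (v : ℕ) (t : Arith) : Arith := not (count v (not t))

def double (t : Arith) : Arith := add t t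

variable {σ : Memory} {ρ : ℕ → ℕ} (e f c : Arith) (v : ℕ)

theorem eval_const (k : ℕ) : (const k).eval σ ρ = k := rfl
theorem eval_var : (var v).eval σ ρ = ρ v := rfl
theorem eval_read (a : ℕ) : (read a e f).eval σ ρ = σ a (e.eval σ ρ) (f.eval σ ρ) := rfl
theorem eval_add : (add e f).eval σ ρ = e.eval σ ρ + f.eval σ ρ := rfl

theorem holds_lt : (lt e f).Holds σ ρ ↔ e.eval σ ρ < f.eval σ ρ := by
  simp only [Holds, lt, eval]
  omega

theorem holds_not : (not e).Holds σ ρ ↔ ¬ e.Holds σ ρ := by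
  simp only [Holds, not, eval]
  split_ifs <;> simp_all

theorem holds_le : (le e f).Holds σ ρ ↔ e.eval σ ρ ≤ f.eval σ ρ := by
  rw [le, holds_not, holds_lt, not_lt]

theorem holds_and : (and e f).Holds σ ρ ↔ e.Holds σ ρ ∧ f.Holds σ ρ := by
  simp only [Holds, and, eval]
  split_ifs <;> simp_all

theorem holds_or : (or e f).Holds σ ρ ↔ e.Holds σ ρ ∨ f.Holds σ ρ := by
  simp only [Holds, or, eval]
  split_ifs <;> simp_all

theorem holds_eq : (eq e f).Holds σ ρ ↔ e.eval σ ρ = f.eval σ ρ := by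
  rw [eq, holds_and, holds_le, holds_le, ← le_antisymm_iff]

theorem holds_read (a : ℕ) :
    (read a e f).Holds σ ρ ↔ σ a (e.eval σ ρ) (f.eval σ ρ) ≠ 0 := Iff.rfl

theorem eval_ite : (ite c e f).eval σ ρ = if c.Holds σ ρ then e.eval σ ρ else f.eval σ ρ := by
  simp only [eval, Holds]
  split_ifs <;> simp_all

theorem holds_ite :
    (ite c e f).Holds σ ρ ↔ if c.Holds σ ρ then e.Holds σ ρ else f.Holds σ ρ := by
  rw [Holds, eval_ite]
  split_ifs <;> rfl

theorem eval_sum {n b : ℕ} (hn : σ 0 0 b = n) :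
    (sum b v e).eval σ ρ = ∑ k : Fin n, e.eval σ (Function.update ρ v k) := by
  rw [eval, hn, Finset.sum_range]

theorem eval_count {n : ℕ} (hn : σ 0 0 0 = n) : (count v e).eval σ ρ =
    (Finset.univ.filter fun k : Fin n => e.Holds σ (Function.update ρ v k)).card := by
  rw [count, eval_sum _ _ hn, Finset.card_filter]
  exact Finset.sum_congr rfl fun k _ => eval_ite ..

theorem holds_ex {n : ℕ} (hn : σ 0 0 0 = n) :
    (ex v e).Holds σ ρ ↔ ∃ k : Fin n, e.Holds σ (Function.update ρ v k) := by
  rw [Holds, ex, eval_count _ _ hn, ← Nat.pos_iff_ne_zero, Finset.card_pos]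
  simp [Finset.Nonempty]

theorem holds_all {n : ℕ} (hn : σ 0 0 0 = n) :
    (all v e).Holds σ ρ ↔ ∀ k : Fin n, e.Holds σ (Function.update ρ v k) := by
  have := holds_ex (σ := σ) (ρ := ρ) (not e) v hn
  rw [all, holds_not, ← ex, this]
  simp [holds_not]

theorem eval_double : (double e).eval σ ρ = 2 * e.eval σ ρ := by
  rw [double, eval, two_mul]

end Arith
end RAM

/-! ### Simple fractional hedonic games as directed graphs -/

namespace SimpleFHG

variable {n : ℕ} (G : SimpleFHG n)

/-- Agent `i` likes agent `j`. -/
def Adj (i j : Fin n) : Prop := G.weight i j = 1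

instance : DecidableRel G.Adj := fun _ _ => inferInstanceAs (Decidable (_ = _))

/-- The agents that `i` likes. -/
def nbrs (i : Fin n) : Finset (Fin n) := Finset.univ.filter (G.Adj i)

theorem mem_nbrs {i j : Fin n} : j ∈ G.nbrs i ↔ G.Adj i j := by simp [nbrs]

theorem not_adj_self (i : Fin n) : ¬ G.Adj i i := by simp [Adj, G.weight_self]

theorem weight_eq (i j : Fin n) : G.weight i j = if G.Adj i j then 1 else 0 := by
  unfold Adj
  rcases G.weight_mem i j with h | h <;> simp [h]

theorem sum_weight (i : Fin n) (S : Finset (Fin n)) :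
    ∑ j ∈ S, G.weight i j = ((S ∩ G.nbrs i).card : ℚ) := by
  simp only [G.weight_eq, Finset.sum_boole, nbrs]
  congr 2
  ext j
  simp

theorem value_eq (i : Fin n) (S : Finset (Fin n)) :
    G.value i S = ((S ∩ G.nbrs i).card : ℚ) / S.card := by
  rw [value, sum_weight]

@[ext]
theorem ext_weight {G G' : SimpleFHG n} (h : ∀ i j, G.weight i j = G'.weight i j) : G = G' := by
  cases G
  cases G'
  congr
  funext i j
  exact h i j

end SimpleFHG

/-! ### The learning program -/

open RAM Arith in
/-- The number `|S_k| v_i(S_k)` of members of sample `k` that `i` likes, for a member `i`: the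
numerator of `v_i(S_k)` times the number of `t < n` with `t · (denominator) < |S_k|`. Here `i` is
the variable `0` and `k` the variable `2`. -/
def likedTerm : Arith :=
  sum 0 3 (ite (lt (sum 0 4 (ite (lt (var 4) (var 3)) (read 3 (var 2) (var 0)) (const 0)))
    (count 4 (read 1 (var 2) (var 4)))) (read 2 (var 2) (var 0)) (const 0))

open RAM Arith in
/-- The decision whether `i` likes `j` (variables `0` and `1`): compare eight times the numbers
`|S_k| v_i(S_k)`, summed over the samples with `i, j ∈ S_k` and over those with
`i ∈ S_k`, `j ∉ S_k`; their difference has to exceed the number of samples. -/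
def learnTerm : Arith :=
  and (not (eq (var 0) (var 1)))
    (lt (add (read 0 (const 0) (const 1)) (double (double (double
        (sum 1 2 (ite (and (read 1 (var 2) (var 0)) (not (read 1 (var 2) (var 1))))
          likedTerm (const 0)))))))
      (double (double (double
        (sum 1 2 (ite (and (read 1 (var 2) (var 0)) (read 1 (var 2) (var 1)))
          likedTerm (const 0)))))))

open RAM Arith in
/-- The learning program tabulates its decisions in array `4`. -/
def learnProgram : Program := tabulate 4 (ite learnTerm (const 1) (const 0))

namespace SimpleFHG

variable {n : ℕ} (G : SimpleFHG n) {m : ℕ}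

/-- The decision that the learning program takes on the pair `(i, j)`. -/
def Inferred (S : Fin m → Finset (Fin n)) (i j : Fin n) : Prop :=
  i ≠ j ∧ m + 8 * (∑ k, if i ∈ S k ∧ j ∉ S k then (S k ∩ G.nbrs i).card else 0) <
    8 * ∑ k, if i ∈ S k ∧ j ∈ S k then (S k ∩ G.nbrs i).card else 0

instance (S : Fin m → Finset (Fin n)) (i j : Fin n) : Decidable (G.Inferred S i j) :=
  inferInstanceAs (Decidable (_ ∧ _))

/-- The game that the learning program returns. -/
def learnedGame (S : Fin m → Finset (Fin n)) : SimpleFHG n where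
  weight i j := if G.Inferred S i j then 1 else 0
  weight_mem i j := by split_ifs <;> simp
  weight_self i := by simp [Inferred]

/-- The numerator of the reduced fraction `a / s` has to be multiplied by `s / den` to recover
`a`, and this factor is the number of `t < n` with `t · den < s`. -/
theorem num_mul_count (a : ℕ) {s : ℕ} (hs : 0 < s) (hsn : s ≤ n) :
    (∑ t : Fin n, if (t : ℕ) * ((a : ℚ) / s).den < s then ((a : ℚ) / s).num.toNat else 0) = a := by
  obtain ⟨c, hc, hc'⟩ := Rat.exists_eq_mul_div_num_and_eq_mul_div_den (a : ℤ) (d := (s : ℤ))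
    (by exact_mod_cast hs.ne')
  set x : ℚ := (a : ℚ) / s with hx
  have hx' : (((a : ℤ) : ℚ) / ((s : ℤ) : ℚ)) = x := by simp [hx]
  rw [hx'] at hc hc'
  have hden : 0 < x.den := x.den_pos
  have hcpos : 0 < c := by
    have : (0 : ℤ) < c * x.den := by rw [← hc']; exact_mod_cast hs
    exact pos_of_mul_pos_left this (by positivity)
  obtain ⟨g, rfl⟩ : ∃ g : ℕ, c = g := ⟨c.toNat, by omega⟩
  have hnum : 0 ≤ x.num := Rat.num_nonneg.2 (by positivity)
  obtain ⟨b, hb⟩ : ∃ b : ℕ, x.num = b := ⟨x.num.toNat, by omega⟩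
  rw [hb] at hc ⊢
  have hs' : s = g * x.den := by exact_mod_cast hc'
  have ha : a = g * b := by exact_mod_cast hc
  have hgn : g ≤ n := (Nat.le_mul_of_pos_right g hden).trans (hs'.symm.le.trans hsn)
  have hiff : ∀ t : ℕ, t * x.den < s ↔ t < g := fun t => by
    rw [hs', Nat.mul_lt_mul_right hden]
  simp only [hiff, Int.toNat_natCast]
  rw [← Finset.sum_range (fun t => if t < g then b else 0), ← Finset.sum_filter, Finset.sum_const,
    ha, smul_eq_mul]
  congr 1
  rw [show (Finset.range n).filter (· < g) = Finset.range g by ext t; simp; omega,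
    Finset.card_range]

section eval

variable (S : Fin m → Finset (Fin n)) {σ : RAM.Memory} {ρ : ℕ → ℕ}

theorem sampleInput_one (k : Fin m) (i : Fin n) :
    G.sampleInput S 1 k i = if i ∈ S k then 1 else 0 := by
  simp [sampleInput]

theorem sampleInput_two (k : Fin m) (i : Fin n) :
    G.sampleInput S 2 k i = if i ∈ S k then (G.value i (S k)).num.toNat else 0 := by
  simp [sampleInput]

theorem sampleInput_three (k : Fin m) (i : Fin n) :
    G.sampleInput S 3 k i = if i ∈ S k then (G.value i (S k)).den else 0 := by
  simp [sampleInput]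

theorem eval_likedTerm (hσ : ∀ a < 4, σ a = G.sampleInput S a) {i : Fin n} {k : Fin m}
    (hik : i ∈ S k) (h0 : ρ 0 = i) (h2 : ρ 2 = k) :
    likedTerm.eval σ ρ = (S k ∩ G.nbrs i).card := by
  have hn : σ 0 0 0 = n := by rw [hσ 0 (by omega)]; rfl
  have hsum : ∀ t : Fin n, (∑ u : Fin n, if u < t then (G.value i (S k)).den else 0) =
      t * (G.value i (S k)).den := by
    intro t
    rw [← Finset.sum_filter, Finset.sum_const, smul_eq_mul]
    congr 1
    rw [show Finset.univ.filter (· < t) = Finset.Iio t by ext; simp, Fin.card_Iio]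
  have hval := G.value_eq i (S k)
  have hpos : 0 < (S k).card := Finset.card_pos.2 ⟨i, hik⟩
  have hle : (S k).card ≤ n := by simpa using Finset.card_le_univ (S k)
  rw [likedTerm, RAM.Arith.eval_sum _ _ hn]
  simp only [RAM.Arith.eval_ite, RAM.Arith.holds_lt, RAM.Arith.eval_sum _ _ hn,
    RAM.Arith.eval_count _ _ hn, RAM.Arith.holds_read, RAM.Arith.eval_const,
    RAM.Arith.eval_var, RAM.Arith.eval_read, Function.update_apply,
    h0, h2, hσ 1 (by omega), hσ 2 (by omega), hσ 3 (by omega)]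
  simp [sampleInput_one, sampleInput_two, sampleInput_three, hik, hsum]
  rw [hval]
  exact num_mul_count _ hpos hle

theorem holds_learnTerm (hσ : ∀ a < 4, σ a = G.sampleInput S a) {i j : Fin n}
    (h0 : ρ 0 = i) (h1 : ρ 1 = j) : learnTerm.Holds σ ρ ↔ G.Inferred S i j := by
  have hm : σ 0 0 1 = m := by rw [hσ 0 (by omega)]; rfl
  rw [learnTerm]
  simp only [RAM.Arith.holds_and, RAM.Arith.holds_not, RAM.Arith.holds_eq, RAM.Arith.holds_lt,
    RAM.Arith.eval_double, RAM.Arith.eval_sum _ _ hm, RAM.Arith.eval_ite, RAM.Arith.holds_read,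
    RAM.Arith.eval_const, RAM.Arith.eval_var, RAM.Arith.eval_read, RAM.Arith.eval_add,
    Function.update_apply, h0, h1, hσ 1 (by omega), hm]
  have hl : ∀ k : Fin m, i ∈ S k → likedTerm.eval σ (Function.update ρ 2 k) =
      (S k ∩ G.nbrs i).card := fun k hk =>
    G.eval_likedTerm S hσ hk (by simpa using h0) (by simp)
  have e1 : ∀ P : Fin m → Prop, ∀ [DecidablePred P],
      (∑ k, if i ∈ S k ∧ P k then likedTerm.eval σ (Function.update ρ 2 (k : ℕ)) else 0) =
      ∑ k, if i ∈ S k ∧ P k then (S k ∩ G.nbrs i).card else 0 := by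
    intro P _
    refine Finset.sum_congr rfl fun k _ => ?_
    split_ifs with h
    · exact hl k h.1
    · rfl
  simp only [Inferred]
  simp [sampleInput_one, e1, Fin.val_inj]
  intro _
  omega

end eval

/-- The learning program halts in polynomial time, and returns the game `learnedGame`. -/
theorem learnsWithin_learnedGame (S : Fin m → Finset (Fin n)) :
    LearnsWithin learnProgram
      ((RAM.tabulateCost (.ite learnTerm (.const 1) (.const 0))).eval (n + m)) G S
      (G.learnedGame S) := by
  obtain ⟨T, τ, hT, hrun, hframe, hval⟩ := RAM.run_tabulate (A := 4)
    (t := .ite learnTerm (.const 1) (.const 0)) (by omega) (by omega) (by decide)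
    (G.sampleInput S) (N := n + m) le_rfl
  refine ⟨T, hT, τ, hrun, fun i j => ?_⟩
  rw [hval i i.2 j j.2, RAM.Arith.eval_ite]
  have := G.holds_learnTerm S (σ := RAM.partialMemory 4 (G.sampleInput S) τ i j)
    (ρ := RAM.env i j) (by
      intro a ha
      funext i' j'
      rw [RAM.partialMemory, if_neg (by omega), hframe a (by omega) (by omega)]) rfl rfl
  simp only [this, learnedGame, RAM.Arith.eval]
  split_ifs <;> simp

end SimpleFHG

/-! ### Exponential tail bounds for random sets -/

/-- `1` for the members of `S`, and `-1` for all other elements. -/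
def signOf {α : Type*} [DecidableEq α] (S : Finset α) (j : α) : ℝ := if j ∈ S then 1 else -1

section signs

variable {α : Type*} [DecidableEq α] [Fintype α]

/-- The signs of a uniformly random set are independent: their moment generating function
factors. -/
theorem sum_exp_signs (c : α → ℝ) :
    ∑ S : Finset α, Real.exp (∑ j, c j * signOf S j) =
      ∏ j, (Real.exp (c j) + Real.exp (-c j)) := by
  rw [Finset.prod_add, Finset.powerset_univ]
  refine Finset.sum_congr rfl fun S _ => ?_
  rw [Real.exp_sum, ← Finset.prod_mul_prod_compl S, ← Finset.compl_eq_univ_sdiff]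
  congr 1
  · exact Finset.prod_congr rfl fun j hj => by simp [signOf, hj]
  · exact Finset.prod_congr rfl fun j hj => by simp [signOf, Finset.mem_compl.1 hj]

/-- The Chernoff bound for signed sums over random sets. -/
theorem card_sum_signs_gt (c : α → ℝ) (hc : ∀ j, |c j| ≤ 1) {l : ℝ} (hl : 0 ≤ l) :
    ((Finset.univ.filter fun S : Finset α => l < ∑ j, c j * signOf S j).card : ℝ) ≤
      2 ^ Fintype.card α * Real.exp (-(l ^ 2 / (2 * Fintype.card α))) := by
  rcases isEmpty_or_nonempty α with hα | hα
  · simp only [Finset.univ_eq_empty, Finset.sum_empty, not_lt.2 hl, Finset.filter_false]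
    simp
  have hn : (0 : ℝ) < Fintype.card α := by exact_mod_cast Fintype.card_pos
  set N : ℝ := (Fintype.card α : ℝ)
  set s := l / N with hs
  have hs0 : 0 ≤ s := by positivity
  have h1 : ((Finset.univ.filter fun S : Finset α => l < ∑ j, c j * signOf S j).card : ℝ) *
      Real.exp (s * l) ≤ ∑ S : Finset α, Real.exp (∑ j, s * c j * signOf S j) := by
    rw [← nsmul_eq_mul]
    refine (Finset.card_nsmul_le_sum _ _ _ fun S hS => ?_).trans
      (Finset.sum_le_sum_of_subset_of_nonneg (Finset.filter_subset _ _)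
      fun _ _ _ => (Real.exp_pos _).le)
    simp only [mul_assoc, ← Finset.mul_sum]
    gcongr
    exact (Finset.mem_filter.1 hS).2.le
  have h2 : ∑ S : Finset α, Real.exp (∑ j, s * c j * signOf S j) ≤
      ∏ _j : α, (2 * Real.exp (s ^ 2 / 2)) := by
    rw [sum_exp_signs]
    refine Finset.prod_le_prod (fun _ _ => by positivity) fun j _ => ?_
    have h := Real.cosh_le_exp_half_sq (s * c j)
    rw [Real.cosh_eq] at h
    have h' : (s * c j) ^ 2 ≤ s ^ 2 := by
      rw [mul_pow]
      have : c j ^ 2 ≤ 1 := by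
        rw [← sq_abs]
        exact pow_le_one₀ (abs_nonneg _) (hc j)
      nlinarith [sq_nonneg s]
    have h'' : Real.exp ((s * c j) ^ 2 / 2) ≤ Real.exp (s ^ 2 / 2) := by gcongr
    linarith
  rw [Finset.prod_const, mul_pow, ← Real.exp_nat_mul, Finset.card_univ] at h2
  have h3 : -(l ^ 2 / (2 * N)) = N * (s ^ 2 / 2) - s * l := by
    rw [hs]
    field_simp
    ring
  rw [h3, Real.exp_sub, ← mul_div_assoc, le_div_iff₀ (Real.exp_pos _)]
  exact h1.trans h2

/-- If `g` does not depend on the membership of `j`, then `g` is uncorrelated with the sign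
of `j`. -/
theorem sum_mul_signOf (j : α) (g : Finset α → ℝ) (hg : ∀ S, g (symmDiff S {j}) = g S) :
    ∑ S : Finset α, g S * signOf S j = 0 := by
  have hinv : Function.Involutive fun S : Finset α => symmDiff S {j} := fun S => by
    simp
  have h := Equiv.sum_comp hinv.toPerm fun S : Finset α => g S * signOf S j
  have h' : ∀ S : Finset α, signOf (symmDiff S {j}) j = -signOf S j := by
    intro S
    by_cases hj : j ∈ S <;> simp [signOf, Finset.mem_symmDiff, hj]
  simp only [Function.Involutive.coe_toPerm, hg, h', mul_neg, Finset.sum_neg_distrib] at h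
  linarith

theorem sum_mul_indicator (j : α) (g : Finset α → ℝ) (hg : ∀ S, g (symmDiff S {j}) = g S) :
    ∑ S : Finset α, g S * (if j ∈ S then 1 else 0) = (∑ S : Finset α, g S) / 2 := by
  have h := sum_mul_signOf j g hg
  have h' : ∀ S : Finset α, g S * (if j ∈ S then (1 : ℝ) else 0) =
      (g S + g S * signOf S j) / 2 := by
    intro S
    by_cases hj : j ∈ S <;> simp [signOf, hj]
  simp only [h', ← Finset.sum_div, Finset.sum_add_distrib, h, add_zero]

end signs

/-- Chernoff's bound for sums of independent, bounded and centred random variables. -/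
theorem card_sum_ge {α : Type*} [Fintype α] (m : ℕ) (Y : α → ℝ) {B : ℝ}
    (hB : 1 ≤ B) (hY : ∀ a, |Y a| ≤ B) (h0 : ∑ a, Y a = 0) :
    ((Finset.univ.filter fun S : Fin m → α => (m : ℝ) / 8 ≤ ∑ k, Y (S k)).card : ℝ) ≤
      (Fintype.card α : ℝ) ^ m * Real.exp (-(m / (256 * B ^ 2))) := by
  classical
  set s : ℝ := 1 / (16 * B ^ 2) with hs
  have hs0 : 0 ≤ s := by positivity
  have hsB : s * B ≤ 1 := by
    rw [hs, div_mul_eq_mul_div, div_le_one (by positivity)]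
    nlinarith
  have h1 : ((Finset.univ.filter fun S : Fin m → α => (m : ℝ) / 8 ≤ ∑ k, Y (S k)).card : ℝ) *
      Real.exp (s * (m / 8)) ≤ ∑ S : Fin m → α, ∏ k, Real.exp (s * Y (S k)) := by
    rw [← nsmul_eq_mul]
    refine (Finset.card_nsmul_le_sum _ _ _ fun S hS => ?_).trans
      (Finset.sum_le_sum_of_subset_of_nonneg (Finset.filter_subset _ _)
      fun _ _ _ => Finset.prod_nonneg fun _ _ => (Real.exp_pos _).le)
    rw [← Real.exp_sum, ← Finset.mul_sum]
    gcongr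
    exact (Finset.mem_filter.1 hS).2
  have h2 : ∑ a, Real.exp (s * Y a) ≤ Fintype.card α * Real.exp (s ^ 2 * B ^ 2) := by
    have : ∀ a, Real.exp (s * Y a) ≤ 1 + s * Y a + s ^ 2 * B ^ 2 := by
      intro a
      have ha : |s * Y a| ≤ s * B := by
        rw [abs_mul, abs_of_nonneg hs0]
        exact mul_le_mul_of_nonneg_left (hY a) hs0
      have h := (abs_le.1 (Real.abs_exp_sub_one_sub_id_le (ha.trans hsB))).2
      have h' : (s * Y a) ^ 2 ≤ (s * B) ^ 2 := sq_le_sq' (abs_le.1 ha).1 (abs_le.1 ha).2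
      nlinarith
    refine (Finset.sum_le_sum fun a _ => this a).trans ?_
    simp only [Finset.sum_add_distrib, ← Finset.mul_sum, h0, Finset.sum_const, Finset.card_univ,
      nsmul_eq_mul, mul_zero, mul_one, add_zero]
    have := mul_le_mul_of_nonneg_left (Real.add_one_le_exp (s ^ 2 * B ^ 2))
      (Nat.cast_nonneg (α := ℝ) (Fintype.card α))
    linarith
  rw [← Fintype.sum_pow (fun a => Real.exp (s * Y a)) m] at h1
  have h3 := h1.trans (pow_le_pow_left₀ (Finset.sum_nonneg fun _ _ => (Real.exp_pos _).le) h2 m)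
  rw [mul_pow, ← Real.exp_nat_mul] at h3
  have h4 : -((m : ℝ) / (256 * B ^ 2)) = m * (s ^ 2 * B ^ 2) - s * (m / 8) := by
    have : B ≠ 0 := by positivity
    rw [hs]
    field_simp
    ring
  rwa [h4, Real.exp_sub, ← mul_div_assoc, le_div_iff₀ (Real.exp_pos _)]

/-! ### Success probability of the learning program -/

namespace SimpleFHG

variable {n : ℕ} (G : SimpleFHG n) {m : ℕ}

/-- The statistic of a sample on which the decision about the pair `(i, j)` is based. -/
noncomputable def pairStat (i j : Fin n) (S : Finset (Fin n)) : ℝ :=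
  if i ∈ S then ((S ∩ G.nbrs i).card : ℝ) * signOf S j else 0

theorem inferred_iff (S : Fin m → Finset (Fin n)) (i j : Fin n) :
    G.Inferred S i j ↔ i ≠ j ∧ (m : ℝ) / 8 < ∑ k, G.pairStat i j (S k) := by
  have h : ∑ k, G.pairStat i j (S k) =
      ((∑ k, if i ∈ S k ∧ j ∈ S k then (S k ∩ G.nbrs i).card else 0 : ℕ) : ℝ) -
      ((∑ k, if i ∈ S k ∧ j ∉ S k then (S k ∩ G.nbrs i).card else 0 : ℕ) : ℝ) := by
    push_cast
    rw [← Finset.sum_sub_distrib]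
    refine Finset.sum_congr rfl fun k _ => ?_
    by_cases hi : i ∈ S k <;> by_cases hj : j ∈ S k <;> simp [pairStat, signOf, hi, hj]
  rw [Inferred, h, ← @Nat.cast_lt ℝ, Nat.cast_add, Nat.cast_mul, Nat.cast_mul, Nat.cast_ofNat]
  constructor
  · rintro ⟨h1, h2⟩
    exact ⟨h1, by linarith⟩
  · rintro ⟨h1, h2⟩
    exact ⟨h1, by linarith⟩

theorem abs_pairStat_le (i j : Fin n) (S : Finset (Fin n)) : |G.pairStat i j S| ≤ n := by
  have h : ((S ∩ G.nbrs i).card : ℝ) ≤ n := by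
    exact_mod_cast (Finset.card_le_univ _).trans_eq (Fintype.card_fin n)
  unfold pairStat signOf
  split_ifs <;> simp [h]

/-- The statistic has mean `v_i(j) / 4`: an agent `l ≠ j` that `i` likes contributes as much to the
samples with `j` as to those without, and `j` contributes to a quarter of the samples. -/
theorem sum_pairStat {i j : Fin n} (hij : i ≠ j) :
    ∑ S, G.pairStat i j S = 2 ^ n * (if G.Adj i j then 1 / 4 else 0) := by
  have h : ∀ S, G.pairStat i j S = ∑ l ∈ G.nbrs i,
      (if i ∈ S then 1 else 0) * (if l ∈ S then 1 else 0) * signOf S j := by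
    intro S
    unfold pairStat
    rw [← Finset.sum_mul, ← Finset.mul_sum, Finset.sum_boole, Finset.inter_comm,
      Finset.filter_mem_eq_inter]
    split_ifs <;> simp
  have hmem : ∀ {a b : Fin n}, a ≠ b → ∀ S : Finset (Fin n), a ∈ symmDiff S {b} ↔ a ∈ S := by
    intro a b hab S
    simp [Finset.mem_symmDiff, hab]
  have h0 : ∀ l ∈ G.nbrs i, l ≠ j → ∑ S : Finset (Fin n),
      (if i ∈ S then (1 : ℝ) else 0) * (if l ∈ S then 1 else 0) * signOf S j = 0 := by
    intro l _ hlj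
    exact sum_mul_signOf j _ fun S => by simp only [hmem hij, hmem hlj]
  have h1 : ∑ S : Finset (Fin n),
      (if i ∈ S then (1 : ℝ) else 0) * (if j ∈ S then 1 else 0) * signOf S j = 2 ^ n / 4 := by
    have e : ∀ S : Finset (Fin n), (if i ∈ S then (1 : ℝ) else 0) * (if j ∈ S then 1 else 0) *
        signOf S j = (if i ∈ S then (1 : ℝ) else 0) * (if j ∈ S then 1 else 0) := by
      intro S
      by_cases hj : j ∈ S <;> simp [signOf, hj]
    rw [Finset.sum_congr rfl fun S _ => e S,
      sum_mul_indicator j _ fun S => by simp only [hmem hij]]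
    have := sum_mul_indicator i (fun _ => 1) fun S => rfl
    simp only [one_mul, Finset.sum_const, Finset.card_univ, Fintype.card_finset,
      Fintype.card_fin, nsmul_eq_mul, mul_one, Nat.cast_pow, Nat.cast_ofNat] at this
    rw [this]
    ring
  simp only [h]
  rw [Finset.sum_comm]
  by_cases hadj : G.Adj i j
  · rw [Finset.sum_eq_single_of_mem j (G.mem_nbrs.2 hadj) h0, h1, if_pos hadj]
    ring
  · rw [if_neg hadj, mul_zero]
    refine Finset.sum_eq_zero fun l hl => h0 l hl ?_
    rintro rfl
    exact hadj (G.mem_nbrs.1 hl)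

/-- A wrong decision on a fixed pair is exponentially unlikely in the number of samples. -/
theorem card_wrong_le (i j : Fin n) :
    ((Finset.univ.filter fun S : Fin m → Finset (Fin n) =>
      ¬ (G.Inferred S i j ↔ G.Adj i j)).card : ℝ) ≤
      (2 ^ n) ^ m * Real.exp (-(m / (1024 * n ^ 2))) := by
  classical
  have hn : (1 : ℝ) ≤ n := by exact_mod_cast (Nat.one_le_iff_ne_zero.2 (by
    rintro rfl
    exact i.elim0))
  by_cases hij : i = j
  · subst hij
    rw [Finset.filter_false_of_mem]
    · simp only [Finset.card_empty, Nat.cast_zero]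
      positivity
    · intro S _
      simp [Inferred, G.not_adj_self]
  have hsum := G.sum_pairStat hij
  have hbound : ∀ Y : Finset (Fin n) → ℝ, (∀ S, |Y S| ≤ 2 * n) → ∑ S, Y S = 0 →
      (∀ S : Fin m → Finset (Fin n), ¬ (G.Inferred S i j ↔ G.Adj i j) →
        (m : ℝ) / 8 ≤ ∑ k, Y (S k)) →
      ((Finset.univ.filter fun S : Fin m → Finset (Fin n) =>
        ¬ (G.Inferred S i j ↔ G.Adj i j)).card : ℝ) ≤
        (2 ^ n) ^ m * Real.exp (-(m / (1024 * n ^ 2))) := by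
    intro Y hY h0 himp
    have h := card_sum_ge m Y (B := 2 * n) (by linarith) hY h0
    rw [Fintype.card_finset, Fintype.card_fin, Nat.cast_pow, Nat.cast_ofNat,
      show 256 * (2 * (n : ℝ)) ^ 2 = 1024 * n ^ 2 by ring] at h
    refine le_trans ?_ h
    exact_mod_cast Finset.card_le_card (Finset.monotone_filter_right _ fun S _ hS => himp S hS)
  by_cases hadj : G.Adj i j
  · refine hbound (fun S => 1 / 4 - G.pairStat i j S) (fun S => ?_) ?_ fun S hS => ?_
    · have := abs_le.1 (G.abs_pairStat_le i j S)
      exact abs_le.2 ⟨by linarith, by linarith⟩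
    · rw [Finset.sum_sub_distrib, hsum, if_pos hadj]
      simp
    · rw [Finset.sum_sub_distrib]
      have : ∑ k, G.pairStat i j (S k) ≤ (m : ℝ) / 8 := by
        by_contra hlt
        exact hS ⟨fun _ => hadj, fun _ => (G.inferred_iff S i j).2 ⟨hij, not_le.1 hlt⟩⟩
      simp only [Finset.sum_const, Finset.card_univ, Fintype.card_fin, nsmul_eq_mul]
      linarith
  · refine hbound (G.pairStat i j) (fun S => (G.abs_pairStat_le i j S).trans (by linarith)) ?_
      fun S hS => ?_
    · rw [hsum, if_neg hadj, mul_zero]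
    · by_contra hlt
      refine hS ⟨fun h => ?_, fun h => absurd h hadj⟩
      exact absurd ((G.inferred_iff S i j).1 h).2.le hlt

theorem learnedGame_eq_of_forall (S : Fin m → Finset (Fin n))
    (h : ∀ i j, G.Inferred S i j ↔ G.Adj i j) : G.learnedGame S = G := by
  ext i j
  simp only [learnedGame, h, G.weight_eq]

/-- The fraction of sample sequences that mislead the learning program. -/
theorem card_learnedGame_ne_le {δ : ℝ} (h0 : 0 < δ) (h1 : δ < 1)
    (hm : 2048 * ((n : ℝ) + Real.log (1 / δ)) ^ 3 ≤ m) :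
    (({S : Fin m → Finset (Fin n) | G.learnedGame S ≠ G} : Set _).ncard : ℝ) ≤
      δ * (2 ^ n) ^ m := by
  classical
  rcases Nat.eq_zero_or_pos n with rfl | hn
  · have : ({S : Fin m → Finset (Fin 0) | G.learnedGame S ≠ G} : Set _) = ∅ := by
      ext S
      simp only [Set.mem_ofPred_eq, Set.mem_empty_iff_false, iff_false, not_not]
      ext i
      exact i.elim0
    rw [this, Set.ncard_empty, Nat.cast_zero]
    positivity
  have hsub : ({S : Fin m → Finset (Fin n) | G.learnedGame S ≠ G} : Set _) ⊆
      ((Finset.univ : Finset (Fin n × Fin n)).biUnion fun p => Finset.univ.filter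
        fun S : Fin m → Finset (Fin n) => ¬ (G.Inferred S p.1 p.2 ↔ G.Adj p.1 p.2) :
        Finset (Fin m → Finset (Fin n))) := by
    intro S hS
    simp only [Finset.coe_biUnion, Finset.coe_univ, Set.mem_univ, Set.iUnion_true,
      Finset.coe_filter, Finset.mem_univ, true_and, Set.mem_iUnion, Set.mem_ofPred_eq, Prod.exists]
    by_contra! hcon
    exact hS (G.learnedGame_eq_of_forall S hcon)
  have hcard := (Set.ncard_le_ncard hsub (Finset.finite_toSet _)).trans
    ((Set.ncard_coe_finset _).le.trans Finset.card_biUnion_le)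
  have hcard' : (({S : Fin m → Finset (Fin n) | G.learnedGame S ≠ G} : Set _).ncard : ℝ) ≤
      ∑ _p : Fin n × Fin n, ((2 : ℝ) ^ n) ^ m * Real.exp (-(m / (1024 * n ^ 2))) := by
    refine le_trans (Nat.cast_le.2 hcard) ?_
    push_cast
    exact Finset.sum_le_sum fun p _ => G.card_wrong_le p.1 p.2
  rw [Finset.sum_const, Finset.card_univ, Fintype.card_prod, Fintype.card_fin, nsmul_eq_mul]
    at hcard'
  refine hcard'.trans ?_
  have hn' : (1 : ℝ) ≤ n := by exact_mod_cast hn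
  have hL : 0 < Real.log (1 / δ) := Real.log_pos (by rw [lt_div_iff₀ h0]; linarith)
  set L := Real.log (1 / δ) with hLdef
  -- `m ≥ 1024 n² (2 n + L)` and `n² ≤ exp (2 n)`.
  have hexp : (n : ℝ) ^ 2 * Real.exp (-(m / (1024 * n ^ 2))) ≤ δ := by
    have hδ : δ = Real.exp (-L) := by
      rw [hLdef, one_div, Real.log_inv, neg_neg, Real.exp_log h0]
    have e1 : (n : ℝ) ≤ Real.exp n := by linarith [Real.add_one_le_exp (n : ℝ)]
    have e2 : (n : ℝ) ^ 2 ≤ Real.exp (2 * n) := by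
      calc (n : ℝ) ^ 2 ≤ Real.exp n ^ 2 := by gcongr
        _ = Real.exp (2 * n) := by rw [← Real.exp_nat_mul]; norm_num
    have e3 : 2 * (n : ℝ) + L ≤ m / (1024 * n ^ 2) := by
      rw [le_div_iff₀ (by positivity)]
      refine le_trans ?_ hm
      have : (n : ℝ) ^ 2 ≤ (n + L) ^ 2 := by gcongr; linarith
      nlinarith [mul_nonneg (sub_nonneg.2 this) (by linarith : (0 : ℝ) ≤ n + L)]
    calc (n : ℝ) ^ 2 * Real.exp (-(m / (1024 * n ^ 2)))
        ≤ Real.exp (2 * n) * Real.exp (-(2 * n + L)) := by gcongr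
      _ = δ := by rw [← Real.exp_add, hδ]; congr 1; ring
  push_cast
  calc (n : ℝ) * n * ((2 ^ n) ^ m * Real.exp (-(m / (1024 * n ^ 2))))
      = (n ^ 2 * Real.exp (-(m / (1024 * n ^ 2)))) * (2 ^ n) ^ m := by ring
    _ ≤ δ * (2 ^ n) ^ m := by gcongr

/-- With probability at least `1 - δ`, the learning program returns the game itself. -/
theorem le_uniformSamples_learnedGame_eq {δ : ℝ} (h0 : 0 < δ) (h1 : δ < 1)
    (hm : 2048 * ((n : ℝ) + Real.log (1 / δ)) ^ 3 ≤ m) :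
    ENNReal.ofReal (1 - δ) ≤ (uniformSamples n m).toOuterMeasure
      {S : Fin m → Finset (Fin n) | G.learnedGame S = G} := by
  classical
  have h := G.card_learnedGame_ne_le h0 h1 hm
  have hc : ({S : Fin m → Finset (Fin n) | G.learnedGame S ≠ G} : Set _) =
      {S : Fin m → Finset (Fin n) | G.learnedGame S = G}ᶜ := rfl
  have hcompl := Set.ncard_add_ncard_compl {S : Fin m → Finset (Fin n) | G.learnedGame S = G}
  rw [hc] at h
  have hcard : Nat.card (Fin m → Finset (Fin n)) = (2 ^ n) ^ m := by simp
  rw [hcard] at hcompl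
  have hcompl' : (({S : Fin m → Finset (Fin n) | G.learnedGame S = G} : Set _).ncard : ℝ) +
      (({S : Fin m → Finset (Fin n) | G.learnedGame S = G}ᶜ : Set _).ncard : ℝ) =
      (2 ^ n) ^ m := by exact_mod_cast hcompl
  rw [uniformSamples, PMF.toOuterMeasure_uniformOfFintype_apply, ← Nat.card_eq_fintype_card,
    ← Nat.card_eq_fintype_card, hcard]
  change _ ≤ (({S : Fin m → Finset (Fin n) | G.learnedGame S = G} : Set _).ncard : ENNReal) / _
  rw [ENNReal.le_div_iff_mul_le (by simp) (by simp)]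
  have e : (((2 ^ n) ^ m : ℕ) : ENNReal) = ENNReal.ofReal ((2 ^ n) ^ m) := by
    rw [← ENNReal.ofReal_natCast]
    push_cast
    rfl
  rw [e, ← ENNReal.ofReal_mul (by linarith), ← ENNReal.ofReal_natCast]
  refine ENNReal.ofReal_le_ofReal ?_
  linarith

end SimpleFHG

/-! ### Agents that no typical coalition attracts -/

namespace SimpleFHG

variable {n : ℕ} (G : SimpleFHG n)

/-- The number of agents that `i` likes. -/
def deg (i : Fin n) : ℕ := (G.nbrs i).card

/-- A set whose size differs from `n / 2` by at most `q² / 2`, and that contains at most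
`(d + q²) / 2` of the `d` agents that any given agent likes. -/
def Typical (q : ℕ) (S : Finset (Fin n)) : Prop :=
  n ≤ 2 * S.card + q ^ 2 ∧ 2 * S.card ≤ n + q ^ 2 ∧
    ∀ i, 2 * (S ∩ G.nbrs i).card ≤ G.deg i + q ^ 2

/-- Agent `i` prefers no typical coalition to the coalition `T`. -/
def Content (q : ℕ) (T : Finset (Fin n)) (i : Fin n) : Prop :=
  ∀ S, G.Typical q S → i ∈ S → G.value i S ≤ G.value i T

variable {G} {q : ℕ} {T : Finset (Fin n)} {i : Fin n}

theorem deg_lt (i : Fin n) : G.deg i < n := by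
  have h : G.nbrs i ⊂ Finset.univ :=
    (Finset.ssubset_univ_iff).2 fun h => G.not_adj_self i (G.mem_nbrs.1 (h ▸ Finset.mem_univ i))
  simpa [deg] using Finset.card_lt_card h

theorem content_of_deg_eq_zero (h : G.deg i = 0) : G.Content q T i := by
  intro S _ _
  have h0 : G.nbrs i = ∅ := Finset.card_eq_zero.1 h
  simp [value_eq, h0]

/-- An agent whose value for its coalition exceeds `(d + q²) / (n - q²)`, where `d` is its degree,
is content; the inequality is stated without division and subtraction. -/
theorem content_of_ratio (hi : i ∈ T)
    (h : (G.deg i + q ^ 2) * T.card + (T ∩ G.nbrs i).card * q ^ 2 ≤ (T ∩ G.nbrs i).card * n) :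
    G.Content q T i := by
  rintro S ⟨hS, -, hS'⟩ hiS
  have hT : 0 < T.card := Finset.card_pos.2 ⟨i, hi⟩
  have hSc : 0 < S.card := Finset.card_pos.2 ⟨i, hiS⟩
  rw [value_eq, value_eq, div_le_div_iff₀ (by exact_mod_cast hSc) (by exact_mod_cast hT)]
  norm_cast
  have h1 := Nat.mul_le_mul_right T.card (hS' i)
  have h2 := Nat.mul_le_mul_left (T ∩ G.nbrs i).card hS
  nlinarith

/-- An agent that likes all other members of a coalition is content if the coalition has the size
of the largest typical sets. -/
theorem content_of_subset (hsub : T ⊆ insert i (G.nbrs i))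
    (hT : n + q ^ 2 ≤ 2 * T.card) : G.Content q T i := by
  rintro S ⟨-, hS, -⟩ hiS
  have hle : S.card ≤ T.card := by omega
  have hnot : i ∉ G.nbrs i := fun h => G.not_adj_self i (G.mem_nbrs.1 h)
  have h1 : (S ∩ G.nbrs i).card + 1 ≤ S.card := by
    rw [← Finset.card_insert_of_notMem fun h => hnot (Finset.mem_inter.1 h).2]
    refine Finset.card_le_card (Finset.insert_subset hiS Finset.inter_subset_left)
  have h2 : T.card ≤ (T ∩ G.nbrs i).card + 1 := by
    rw [← Finset.card_insert_of_notMem fun h => hnot (Finset.mem_inter.1 h).2]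
    refine Finset.card_le_card fun j hj => ?_
    have := hsub hj
    simp only [Finset.mem_insert, Finset.mem_inter] at this ⊢
    tauto
  rw [value_eq, value_eq, div_le_div_iff₀ (by exact_mod_cast (by omega : 0 < S.card))
    (by exact_mod_cast (by omega : 0 < T.card))]
  norm_cast
  nlinarith

/-! ### Greedy choices -/

/-- A greedy choice, which accepts an agent only if fewer than `k` agents have been accepted
before, accepts at most `k` agents. -/
theorem card_le_of_greedy {P : Fin n → Prop} [DecidablePred P] {k : ℕ}
    (h : ∀ i, P i → (Finset.univ.filter fun j => j < i ∧ P j).card < k) :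
    (Finset.univ.filter P).card ≤ k := by
  rcases (Finset.univ.filter P).eq_empty_or_nonempty with he | hne
  · simp [he]
  · have hmem := Finset.max'_mem _ hne
    set x := (Finset.univ.filter P).max' hne with hx
    have hlt := h x (Finset.mem_filter.1 hmem).2
    have hsub : Finset.univ.filter P ⊆
        insert x (Finset.univ.filter fun j => j < x ∧ P j) := by
      intro j hj
      have hle : j ≤ x := Finset.le_max' _ j hj
      rcases hle.eq_or_lt with rfl | hlt
      · exact Finset.mem_insert_self _ _
      · exact Finset.mem_insert_of_mem (by simpa using ⟨hlt, (Finset.mem_filter.1 hj).2⟩)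
    exact (Finset.card_le_card hsub).trans ((Finset.card_insert_le _ _).trans hlt)

theorem card_filter_lt_le {P : Fin n → Prop} [DecidablePred P] (i : Fin n) :
    (Finset.univ.filter fun j => j < i ∧ P j).card ≤ (Finset.univ.filter P).card :=
  Finset.card_le_card (Finset.monotone_filter_right _ fun _ _ h => h.2)

/-! ### Coalitions for agents of medium, low and high degree -/

variable (G q)

/-- Agents of medium degree. -/
def Medium (i : Fin n) : Prop := q ^ 2 ≤ G.deg i ∧ G.deg i + 4 * q ^ 2 ≤ n
/-- Agents of low, but positive degree. -/
def Low (i : Fin n) : Prop := 1 ≤ G.deg i ∧ G.deg i < q ^ 2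
/-- Agents that like all but less than `4 q²` agents. -/
def High (i : Fin n) : Prop := n < G.deg i + 4 * q ^ 2

instance : DecidablePred (G.Medium q) := fun _ => inferInstanceAs (Decidable (_ ∧ _))
instance : DecidablePred (G.Low q) := fun _ => inferInstanceAs (Decidable (_ ∧ _))
instance : DecidablePred (G.High q) := fun _ => inferInstanceAs (Decidable (_ < _))

/-- An agent of high degree that all but at most `8 q²` agents of high degree like. -/
def Good (i : Fin n) : Prop :=
  G.High q i ∧ (Finset.univ.filter fun j => G.High q j ∧ ¬ G.Adj j i).card ≤ 8 * q ^ 2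

instance : DecidablePred (G.Good q) := fun _ => inferInstanceAs (Decidable (_ ∧ _))

variable {G q} {H : Finset (Fin n)} {label : Fin n → ℕ}

/-- Disjoint stars, chosen greedily, with centres in `H` and `q` leaves each make the centres
content. Since the degrees are at least `q²`, the greedy choice does not run out of leaves. -/
theorem content_of_stars {leaf : Fin n → Fin n → Prop} [∀ i, DecidablePred (leaf i)]
    (hq : 2 ≤ q) (hn : n < (q + 1) ^ 3)
    (hH : ∀ i ∈ H, G.Medium q i) (hk : H.card * (q + 1) ≤ q ^ 2)
    (hleaf : ∀ i j, leaf i j ↔ i ∈ H ∧ j ∉ H ∧ G.Adj i j ∧ (∀ i' < i, ¬ leaf i' j) ∧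
      (Finset.univ.filter fun j' => j' < j ∧ leaf i j').card < q)
    (hcentre : ∀ j ∈ H, label j = j + 1) (hlabel : ∀ i j, leaf i j → label j = i + 1)
    (hrest : ∀ j ∉ H, (∀ i, ¬ leaf i j) → label j = 0) :
    ∀ i ∈ H, G.Content q (Finset.univ.filter fun j => label j = label i) i := by
  have hle : ∀ i, (Finset.univ.filter (leaf i)).card ≤ q := fun i =>
    card_le_of_greedy fun j hj => ((hleaf i j).1 hj).2.2.2.2
  have heq : ∀ i ∈ H, (Finset.univ.filter (leaf i)).card = q := by
    intro i hi
    by_contra hne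
    have hlt : (Finset.univ.filter (leaf i)).card < q := lt_of_le_of_ne (hle i) hne
    have hsub : G.nbrs i ⊆ H ∪ ((H.erase i).biUnion (fun i' => Finset.univ.filter (leaf i')) ∪
        Finset.univ.filter (leaf i)) := by
      intro j hj
      by_contra hcon
      simp only [Finset.mem_union, Finset.mem_biUnion, Finset.mem_filter, Finset.mem_univ,
        true_and, not_or, not_exists, not_and, Finset.mem_erase] at hcon
      refine hcon.2.2 ((hleaf i j).2 ⟨hi, hcon.1, G.mem_nbrs.1 hj, fun i' hi' hl => ?_, ?_⟩)
      · exact hcon.2.1 i' ⟨hi'.ne, ((hleaf i' j).1 hl).1⟩ hl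
      · exact (card_filter_lt_le j).trans_lt hlt
    have hc := Finset.card_le_card hsub
    have h1 := Finset.card_union_le H ((H.erase i).biUnion (fun i' => Finset.univ.filter
      (leaf i')) ∪ Finset.univ.filter (leaf i))
    have h2 := Finset.card_union_le ((H.erase i).biUnion (fun i' => Finset.univ.filter
      (leaf i'))) (Finset.univ.filter (leaf i))
    have h3 : ((H.erase i).biUnion (fun i' => Finset.univ.filter (leaf i'))).card ≤
        (H.card - 1) * q := by
      rw [← Finset.card_erase_of_mem hi]
      exact Finset.card_biUnion_le_card_mul _ _ _ fun i' _ => hle i'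
    have h4 : q ^ 2 ≤ (G.nbrs i).card := (hH i hi).1
    obtain ⟨c, hc'⟩ : ∃ c, H.card = c + 1 :=
      Nat.exists_eq_succ_of_ne_zero (Finset.card_pos.2 ⟨i, hi⟩).ne'
    rw [hc'] at hk h1 h3
    simp only [Nat.add_sub_cancel] at h3
    nlinarith
  intro i hi
  have hpart : (Finset.univ.filter fun j => label j = label i) =
      insert i (Finset.univ.filter (leaf i)) := by
    ext j
    simp only [Finset.mem_filter, Finset.mem_univ, true_and, Finset.mem_insert, hcentre i hi]
    constructor
    · intro h
      by_cases hj : j ∈ H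
      · left
        rw [hcentre j hj] at h
        exact Fin.ext (by omega)
      · by_cases hl : ∃ i', leaf i' j
        · obtain ⟨i', hl⟩ := hl
          right
          rw [hlabel i' j hl] at h
          rwa [← Fin.ext (show (i' : ℕ) = i by omega)]
        · rw [hrest j hj (not_exists.1 hl)] at h
          omega
    · rintro (rfl | h)
      · exact hcentre j hi
      · exact hlabel i j h
  have hni : i ∉ Finset.univ.filter (leaf i) := fun h =>
    ((hleaf i i).1 (Finset.mem_filter.1 h).2).2.1 hi
  have hinter : insert i (Finset.univ.filter (leaf i)) ∩ G.nbrs i =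
      Finset.univ.filter (leaf i) := by
    ext j
    simp only [Finset.mem_inter, Finset.mem_insert, Finset.mem_filter, Finset.mem_univ, true_and,
      G.mem_nbrs]
    constructor
    · rintro ⟨rfl | h, h'⟩
      · exact absurd h' (G.not_adj_self j)
      · exact h
    · exact fun h => ⟨Or.inr h, ((hleaf i j).1 h).2.2.1⟩
  rw [hpart]
  refine content_of_ratio (Finset.mem_insert_self _ _) ?_
  rw [hinter, Finset.card_insert_of_notMem hni, heq i hi]
  obtain ⟨-, hd⟩ := hH i hi
  have h1 : (G.deg i + 4 * q ^ 2) * (q + 1) ≤ n * (q + 1) := Nat.mul_le_mul_right _ hd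
  have h2 : q * 4 ≤ q * q ^ 2 := Nat.mul_le_mul_left _ (by nlinarith)
  nlinarith

/-- The coalition of the agents in `H` and one liked agent for each of them makes the agents in `H`
content, if their degrees are low. -/
theorem content_of_choice (hq : 2 ≤ q) (hn : q ^ 3 ≤ n) (hH : ∀ i ∈ H, G.Low q i)
    (hk : 128 * H.card ≤ q)
    (hlabel : ∀ j, label j = 1 ↔ j ∈ H ∨ ∃ i ∈ H, G.Adj i j ∧ ∀ j' < j, ¬ G.Adj i j') :
    ∀ i ∈ H, G.Content q (Finset.univ.filter fun j => label j = label i) i := by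
  classical
  intro i hi
  rw [(hlabel i).2 (Or.inl hi)]
  set T := Finset.univ.filter fun j => label j = 1 with hT
  have hmem : ∀ j, j ∈ T ↔ label j = 1 := by simp [hT]
  have hsub : T ⊆ H ∪ H.biUnion fun i =>
      Finset.univ.filter fun j => G.Adj i j ∧ ∀ j' < j, ¬ G.Adj i j' := by
    intro j hj
    rw [hmem, hlabel] at hj
    simpa using hj
  have hone : ∀ i ∈ H, (Finset.univ.filter fun j =>
      G.Adj i j ∧ ∀ j' < j, ¬ G.Adj i j').card ≤ 1 := by
    intro i _
    refine Finset.card_le_one.2 fun a ha b hb => ?_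
    simp only [Finset.mem_filter, Finset.mem_univ, true_and] at ha hb
    exact le_antisymm (not_lt.1 fun h => ha.2 b h hb.1) (not_lt.1 fun h => hb.2 a h ha.1)
  have hcard : T.card ≤ 2 * H.card := by
    have h1 := Finset.card_le_card hsub
    have h2 := Finset.card_union_le H (H.biUnion fun i =>
      Finset.univ.filter fun j => G.Adj i j ∧ ∀ j' < j, ¬ G.Adj i j')
    have h3 := Finset.card_biUnion_le_card_mul _ _ _ hone
    omega
  obtain ⟨hd, hd'⟩ := hH i hi
  have hne : (G.nbrs i).Nonempty := Finset.card_pos.1 hd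
  have hpos : 1 ≤ (T ∩ G.nbrs i).card := by
    refine Finset.card_pos.2 ⟨(G.nbrs i).min' hne, Finset.mem_inter.2
      ⟨(hmem _).2 ((hlabel _).2 (Or.inr ⟨i, hi, ?_, fun j' hj' hadj => ?_⟩)),
        Finset.min'_mem _ hne⟩⟩
    · exact G.mem_nbrs.1 (Finset.min'_mem _ hne)
    · exact absurd (Finset.min'_le _ _ (G.mem_nbrs.2 hadj)) (not_le.2 hj')
  refine content_of_ratio ((hmem i).2 ((hlabel i).2 (Or.inl hi))) ?_
  have h1 : (G.deg i + q ^ 2) * T.card ≤ 2 * q ^ 2 * (2 * H.card) :=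
    Nat.mul_le_mul (by omega) hcard
  have h2 : 128 * H.card * q ^ 2 ≤ q * q ^ 2 := Nat.mul_le_mul_right _ hk
  have h3 : 2 * q ^ 2 ≤ q * q ^ 2 := Nat.mul_le_mul_right _ hq
  have h4 : q * q ^ 2 ≤ n := by rwa [← pow_succ']
  have h5 : (G.deg i + q ^ 2) * T.card + q ^ 2 ≤ n := by nlinarith
  obtain ⟨c, hc⟩ : ∃ c, (T ∩ G.nbrs i).card = c + 1 := Nat.exists_eq_succ_of_ne_zero (by omega)
  rw [hc]
  have h6 : c * q ^ 2 ≤ c * n := Nat.mul_le_mul_left _ (by omega)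
  nlinarith

theorem card_not_adj (i : Fin n) :
    (Finset.univ.filter fun j => ¬ G.Adj i j).card + G.deg i = n := by
  have h := Finset.card_filter_add_card_filter_not (s := (Finset.univ : Finset (Fin n))) (G.Adj i)
  rw [Finset.card_univ, Fintype.card_fin] at h
  rw [deg, nbrs]
  omega

/-- The common liked agents of a clique `H` of agents of high degree form, together with `H`, a
coalition that makes the agents in `H` content. -/
theorem content_of_clique (hq : 2 ≤ q) (hn : q ^ 3 ≤ n) (hH : ∀ i ∈ H, G.High q i)
    (hk : 128 * H.card ≤ q) (hclique : ∀ i ∈ H, ∀ j ∈ H, i = j ∨ G.Adj i j)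
    (hlabel : ∀ j, label j = 1 ↔ ∀ i ∈ H, i = j ∨ G.Adj i j) :
    ∀ i ∈ H, G.Content q (Finset.univ.filter fun j => label j = label i) i := by
  classical
  intro i hi
  have hmem : ∀ j ∈ H, label j = 1 := fun j hj =>
    (hlabel j).2 fun i hi => hclique i hi j hj
  rw [hmem i hi]
  refine content_of_subset (fun j hj => ?_) ?_
  · simp only [Finset.mem_filter, Finset.mem_univ, true_and, hlabel] at hj
    rcases hj i hi with rfl | h
    · exact Finset.mem_insert_self _ _
    · exact Finset.mem_insert_of_mem (G.mem_nbrs.2 h)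
  · have hsub : (Finset.univ.filter fun j => ¬ label j = 1) ⊆
        H.biUnion fun i => Finset.univ.filter fun j => ¬ G.Adj i j := by
      intro j hj
      simp only [Finset.mem_filter, Finset.mem_univ, true_and, hlabel, not_forall, not_or] at hj
      obtain ⟨i', hi', -, h⟩ := hj
      simpa using ⟨i', hi', h⟩
    have h1 := (Finset.card_le_card hsub).trans
      (Finset.card_biUnion_le_card_mul _ _ (4 * q ^ 2) fun i' hi' => by
        have := card_not_adj (G := G) i'
        have h := hH i' hi'
        unfold High at h
        omega)
    have h := Finset.card_filter_add_card_filter_not (s := (Finset.univ : Finset (Fin n)))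
      (fun j => label j = 1)
    rw [Finset.card_univ, Fintype.card_fin] at h
    have h2 : 128 * H.card * q ^ 2 ≤ q * q ^ 2 := Nat.mul_le_mul_right _ hk
    have h3 : 2 * q ^ 2 ≤ q * q ^ 2 := Nat.mul_le_mul_right _ hq
    have h4 : q * q ^ 2 ≤ n := by rwa [← pow_succ']
    nlinarith

/-- At least half of the agents of high degree are good, by double counting. -/
theorem card_high_le :
    (Finset.univ.filter (G.High q)).card ≤ 2 * (Finset.univ.filter (G.Good q)).card := by
  classical
  set A := Finset.univ.filter (G.High q) with hA
  set B := Finset.univ.filter fun i => G.High q i ∧ ¬ G.Good q i with hB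
  have hsplit : A.card = (Finset.univ.filter (G.Good q)).card + B.card := by
    rw [hA, ← Finset.card_filter_add_card_filter_not (G.Good q), Finset.filter_filter,
      Finset.filter_filter]
    congr 2
    ext i
    simp only [Finset.mem_filter, Finset.mem_univ, true_and]
    exact ⟨fun h => h.2, fun h => ⟨h.1, h⟩⟩
  -- Count the pairs `(i, j)` with `i` in `B`, `j` in `A` such that `j` does not like `i`.
  have hcount : ∑ i ∈ B, (A.filter fun j => ¬ G.Adj j i).card =
      ∑ j ∈ A, (B.filter fun i => ¬ G.Adj j i).card :=
    Finset.sum_card_bipartiteAbove_eq_sum_card_bipartiteBelow fun i j => ¬ G.Adj j i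
  have hlow : B.card * (8 * q ^ 2) ≤ ∑ i ∈ B, (A.filter fun j => ¬ G.Adj j i).card := by
    rw [← smul_eq_mul]
    refine Finset.card_nsmul_le_sum _ _ _ fun i hi => ?_
    simp only [hB, Finset.mem_filter, Finset.mem_univ, true_and, Good, not_and, not_le] at hi
    rw [hA, Finset.filter_filter]
    exact (hi.2 hi.1).le
  have hup : ∑ j ∈ A, (B.filter fun i => ¬ G.Adj j i).card ≤ A.card * (4 * q ^ 2) := by
    rw [← smul_eq_mul]
    refine Finset.sum_le_card_nsmul _ _ _ fun j hj => ?_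
    have h1 : (B.filter fun i => ¬ G.Adj j i).card ≤
        (Finset.univ.filter fun i => ¬ G.Adj j i).card :=
      Finset.card_le_card (Finset.filter_subset_filter _ (Finset.subset_univ _))
    have h2 := card_not_adj (G := G) j
    have h3 : G.High q j := (Finset.mem_filter.1 hj).2
    unfold High at h3
    omega
  rcases Nat.eq_zero_or_pos q with rfl | hq
  · have : A = ∅ := by
      refine Finset.filter_eq_empty_iff.2 fun i _ h => ?_
      have := deg_lt (G := G) i
      unfold High at h
      omega
    simp [this]
  · have hq2 : 0 < 4 * q ^ 2 := by positivity
    have : 2 * B.card ≤ A.card := by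
      refine Nat.le_of_mul_le_mul_right ?_ hq2
      calc 2 * B.card * (4 * q ^ 2) = B.card * (8 * q ^ 2) := by ring
        _ ≤ A.card * (4 * q ^ 2) := hlow.trans (hcount.le.trans hup)
    omega

/-- A greedy choice of good agents that like each other finds `k` of them, since every chosen agent
rules out at most `12 q²` good agents. -/
theorem card_greedy_clique {k : ℕ} (hq : 2 ≤ q) (hn : q ^ 3 ≤ n) (hk : 128 * k ≤ q)
    (hH : ∀ i, i ∈ H ↔ G.Good q i ∧ (Finset.univ.filter fun j => j < i ∧ j ∈ H).card < k ∧
      ∀ j < i, j ∈ H → G.Adj i j ∧ G.Adj j i)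
    (hzero : (Finset.univ.filter fun i => G.deg i = 0).card < k)
    (hlow : (Finset.univ.filter (G.Low q)).card < k)
    (hmed : (Finset.univ.filter (G.Medium q)).card < k) : k ≤ H.card := by
  classical
  by_contra hlt
  have hfilter : Finset.univ.filter (· ∈ H) = H := by simp
  have hsub : Finset.univ.filter (G.Good q) ⊆ H.biUnion fun i =>
      (Finset.univ.filter fun j => ¬ G.Adj i j) ∪
        (Finset.univ.filter fun j => G.High q j ∧ ¬ G.Adj j i) := by
    intro j hj
    have hj' := (Finset.mem_filter.1 hj).2
    rw [Finset.mem_biUnion]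
    by_cases hjH : j ∈ H
    · exact ⟨j, hjH, by simp [G.not_adj_self]⟩
    · by_contra! hcon
      refine hjH ((hH j).2 ⟨hj', ?_, fun i _ hi => ?_⟩)
      · refine (card_filter_lt_le j).trans_lt ?_
        rw [hfilter]
        omega
      · have := hcon i hi
        simp only [Finset.mem_union, Finset.mem_filter, Finset.mem_univ, true_and, not_or,
          not_not, hj'.1] at this
        exact ⟨this.2, this.1⟩
  have h1 := (Finset.card_le_card hsub).trans
    (Finset.card_biUnion_le_card_mul _ _ (12 * q ^ 2) fun i hi => by
      have h := ((hH i).1 hi).1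
      have h2 := card_not_adj (G := G) i
      have h3 : n < G.deg i + 4 * q ^ 2 := h.1
      have h4 := h.2
      exact (Finset.card_union_le _ _).trans (by omega))
  have h2 := card_high_le (G := G) (q := q)
  have hcover : (Finset.univ : Finset (Fin n)) ⊆ (Finset.univ.filter fun i => G.deg i = 0) ∪
      (Finset.univ.filter (G.Low q) ∪ (Finset.univ.filter (G.Medium q) ∪
        Finset.univ.filter (G.High q))) := by
    intro i _
    simp only [Finset.mem_union, Finset.mem_filter, Finset.mem_univ, true_and, Low, Medium, High]
    omega
  have h3 := Finset.card_le_card hcover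
  rw [Finset.card_univ, Fintype.card_fin] at h3
  have h4 := Finset.card_union_le (Finset.univ.filter fun i => G.deg i = 0)
    (Finset.univ.filter (G.Low q) ∪ (Finset.univ.filter (G.Medium q) ∪
        Finset.univ.filter (G.High q)))
  have h5 := Finset.card_union_le (Finset.univ.filter (G.Low q))
    (Finset.univ.filter (G.Medium q) ∪ Finset.univ.filter (G.High q))
  have h6 := Finset.card_union_le (Finset.univ.filter (G.Medium q))
    (Finset.univ.filter (G.High q))
  have h7 : 128 * k * q ^ 2 ≤ q * q ^ 2 := Nat.mul_le_mul_right _ hk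
  have h8 : q * q ^ 2 ≤ n := by rwa [← pow_succ']
  have h9 : H.card * (12 * q ^ 2) ≤ k * (12 * q ^ 2) := Nat.mul_le_mul_right _ (by omega)
  have h10 : k * 1 ≤ k * q ^ 2 := Nat.mul_le_mul_left _ (by nlinarith)
  nlinarith

end SimpleFHG

/-! ### Recursions in the final memory -/

namespace RAM

/-- The term `t` does not depend on the array `a`. -/
def Arith.avoids (a : ℕ) : Arith → Bool
  | .const _ => true
  | .var _ => true
  | .read a' e f => decide (a' ≠ a) && (avoids a e && avoids a f)
  | .add e f => avoids a e && avoids a f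
  | .sub e f => avoids a e && avoids a f
  | .ite c e f => avoids a c && (avoids a e && avoids a f)
  | .sum _ _ t => decide (a ≠ 0) && avoids a t

theorem Arith.eval_congr_of_avoids {σ τ : Memory} (t : Arith)
    (h : ∀ a, σ a ≠ τ a → t.avoids a = true) (ρ : ℕ → ℕ) : t.eval σ ρ = t.eval τ ρ := by
  induction t generalizing ρ with
  | const c => rfl
  | var v => rfl
  | read a e f he hf =>
    simp only [avoids, Bool.and_eq_true, decide_eq_true_eq] at h
    have ha : σ a = τ a := by
      by_contra hne
      exact (h a hne).1 rfl
    simp only [eval, ha, he fun a ha => (h a ha).2.1, hf fun a ha => (h a ha).2.2]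
  | add e f he hf =>
    simp only [avoids, Bool.and_eq_true] at h
    simp only [eval, he fun a ha => (h a ha).1, hf fun a ha => (h a ha).2]
  | sub e f he hf =>
    simp only [avoids, Bool.and_eq_true] at h
    simp only [eval, he fun a ha => (h a ha).1, hf fun a ha => (h a ha).2]
  | ite c e f hc he hf =>
    simp only [avoids, Bool.and_eq_true] at h
    simp only [eval, hc fun a ha => (h a ha).1, he fun a ha => (h a ha).2.1,
      hf fun a ha => (h a ha).2.2]
  | sum b v t ht =>
    simp only [avoids, Bool.and_eq_true, decide_eq_true_eq] at h
    have h0 : σ 0 = τ 0 := by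
      by_contra hne
      exact (h 0 hne).1 rfl
    simp only [eval, h0]
    exact Finset.sum_congr rfl fun k _ => ht (fun a ha => (h a ha).2) _

theorem partialMemory_of_ne {A a : ℕ} (h : a ≠ A) (σ τ : Memory) (i j : ℕ) :
    partialMemory A σ τ i j a = τ a := by
  funext i' j'
  rw [partialMemory, if_neg (by tauto)]

theorem partialMemory_of_lt {A i j i' j' : ℕ} (h : i' < i ∨ i' = i ∧ j' < j) (σ τ : Memory) :
    partialMemory A σ τ i j A i' j' = τ A i' j' := by
  rw [partialMemory, if_neg (by tauto)]

theorem Tabulated.frame {n : ℕ} {l : List (ℕ × Arith)} {σ τ : Memory} (h : Tabulated n σ l τ) :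
    ∀ a < 20, (∀ x ∈ l, x.1 ≠ a) → τ a = σ a := by
  induction l generalizing σ with
  | nil =>
    intro a _ _
    rw [show τ = σ from h]
  | cons x l ih =>
    intro a ha hx
    obtain ⟨υ, ⟨hu, -⟩, hτ⟩ := h
    rw [ih hτ a ha fun y hy => hx y (List.mem_cons_of_mem _ hy),
      hu a ha (hx x List.mem_cons_self).symm]

/-- If no array is changed after it has been read or tabulated, then the recursions of all
tabulations hold in the final memory. -/
theorem Tabulated.spec {n : ℕ} {l : List (ℕ × Arith)} {σ τ : Memory} (h : Tabulated n σ l τ)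
    (hl : l.all (fun x => decide (x.1 < 20)) = true)
    (hp : l.Pairwise fun x y => x.1 ≠ y.1 ∧ x.2.avoids y.1 = true)
    (hout : ∀ x ∈ l, ∀ a, 20 ≤ a → x.2.avoids a = true) :
    ∀ x ∈ l, ∀ i < n, ∀ j < n, τ x.1 i j = x.2.eval (partialMemory x.1 σ τ i j) (env i j) := by
  induction l generalizing σ with
  | nil => simp
  | cons y l ih =>
    obtain ⟨A, t⟩ := y
    obtain ⟨υ, ⟨hu, hval⟩, hτ⟩ := h
    simp only [List.all_cons, Bool.and_eq_true, decide_eq_true_eq] at hl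
    obtain ⟨hA, hl⟩ := hl
    rw [List.pairwise_cons] at hp
    obtain ⟨hy, hp⟩ := hp
    have hl' : ∀ x ∈ l, x.1 < 20 := by simpa using hl
    intro x hx i hi j hj
    rcases List.mem_cons.1 hx with rfl | hx
    · have hframe := Tabulated.frame hτ
      change τ A i j = t.eval _ _
      rw [hframe A hA (fun x hx => (hy x hx).1.symm), hval i hi j hj]
      refine Arith.eval_congr_of_avoids t (fun a ha => ?_) _
      by_cases ha20 : a < 20
      · by_cases hmem : ∀ x ∈ l, x.1 ≠ a
        · refine absurd ?_ ha
          funext i' j'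
          simp only [partialMemory, hframe a ha20 hmem]
        · push Not at hmem
          obtain ⟨x, hx, rfl⟩ := hmem
          exact (hy x hx).2
      · exact hout _ List.mem_cons_self a (by omega)
    · rw [ih hτ hl hp (fun x hx => hout x (List.mem_cons_of_mem _ hx)) x hx i hi j hj]
      congr 1
      funext a i' j'
      by_cases ha : a = x.1
      · subst ha
        simp only [partialMemory, hu x.1 (hl' x hx) (hy x hx).1.symm]
      · rw [partialMemory_of_ne ha, partialMemory_of_ne ha]

/-- Well-formed terms avoid the work space. -/
theorem Arith.avoids_of_wf {d a : ℕ} {t : Arith} (h : t.wf d = true) (ha : 20 ≤ a) :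
    t.avoids a = true := by
  induction t generalizing d with
  | const c => rfl
  | var v => rfl
  | read a' e f he hf =>
    simp only [wf, Bool.and_eq_true, decide_eq_true_eq] at h
    simp only [avoids, he h.2.1, hf h.2.2, Bool.and_eq_true, decide_eq_true_eq, and_true]
    omega
  | add e f he hf =>
    simp only [wf, Bool.and_eq_true] at h
    simp only [avoids, he h.1, hf h.2, Bool.and_self]
  | sub e f he hf =>
    simp only [wf, Bool.and_eq_true] at h
    simp only [avoids, he h.1, hf h.2, Bool.and_self]
  | ite c e f hc he hf =>
    simp only [wf, Bool.and_eq_true] at h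
    simp only [avoids, hc h.1, he h.2.1, hf h.2.2, Bool.and_self]
  | sum b v t ht =>
    simp only [wf, Bool.and_eq_true, decide_eq_true_eq] at h
    simp only [avoids, ht h.2, Bool.and_eq_true, decide_eq_true_eq, and_true]
    omega

end RAM

/-! ### The computation program -/

namespace PartitionProgram

open RAM Arith

/-- Entry `(x, 0)` of the array `a`. -/
def entry (a : ℕ) (x : Arith) : Arith := read a x (const 0)

/-- The number `n` of agents. -/
def agents : Arith := entry 0 (const 0)

/-- The relation "`x` likes `y`". -/
def likes (x y : Arith) : Arith := read 1 x y

/-- The integral part `q` of the cube root of `n`. -/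
def root : Arith := entry 3 (const 0)

/-- The number `q²`. -/
def rootSq : Arith := entry 4 (const 0)

/-- The number `k = q / 128` of agents that are to be made content. -/
def quota : Arith := entry 5 (const 0)

/-- The degree of `x`. -/
def degree (x : Arith) : Arith := entry 6 x

/-- The kind of agents that are to be made content: `0` stands for medium, `1` for low, and `2`
for high degree. -/
def mode : Arith := entry 7 (const 0)

/-- The agents among which those to be made content are chosen. -/
def candidate (x : Arith) : Arith := entry 8 x

/-- The agents that are to be made content. -/
def chosen (x : Arith) : Arith := entry 9 x

/-- The relation "`y` is a leaf of the star with centre `x`". -/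
def leaf (x y : Arith) : Arith := read 10 x y

/-- Agent `x` has medium degree. -/
def medium (x : Arith) : Arith :=
  and (le rootSq (degree x)) (le (add (degree x) (double (double rootSq))) agents)

/-- Agent `x` has low, but positive degree. -/
def low (x : Arith) : Arith := and (le (const 1) (degree x)) (lt (degree x) rootSq)

/-- Agent `x` has high degree. -/
def high (x : Arith) : Arith := lt agents (add (degree x) (double (double rootSq)))

/-- The cube of `(var 2) + 1`, as the number of triples of numbers up to `var 2`. -/
def cubeTerm : Arith :=
  sum 0 3 (ite (le (var 3) (var 2)) (sum 0 4 (ite (le (var 4) (var 2))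
    (count 5 (le (var 5) (var 2))) (const 0))) (const 0))

/-- The number of `r < n` with `(r + 1)³ ≤ n`. -/
def rootTerm : Arith := count 2 (le cubeTerm agents)

/-- The square of the root, as the sum of `q` summands `q`. -/
def rootSqTerm : Arith := sum 0 2 (ite (lt (var 2) root) root (const 0))

/-- The number of `r < n` with `128 (r + 1) ≤ q`. -/
def quotaTerm : Arith :=
  count 2 (le (double (double (double (double (double (double (double
    (add (var 2) (const 1))))))))) root)

/-- The degree of agent `var 0`. -/
def degreeTerm : Arith := count 2 (likes (var 0) (var 2))

/-- Medium degrees are preferred to low degrees, and these to high degrees, if there are enough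
agents of that kind. -/
def modeTerm : Arith :=
  ite (le quota (count 2 (medium (var 2)))) (const 0)
    (ite (le quota (count 2 (low (var 2)))) (const 1) (const 2))

/-- The agents of the kind in question; of the agents of high degree, only those that at most `8 q²`
agents of high degree do not like. -/
def candidateTerm : Arith :=
  ite (eq mode (const 0)) (medium (var 0)) (ite (eq mode (const 1)) (low (var 0))
    (and (high (var 0)) (le (count 2 (and (high (var 2)) (not (likes (var 2) (var 0)))))
      (double (double (double rootSq))))))

/-- The greedy choice of up to `k` candidates, in the order of their numbers. In the case of high
degree the chosen agents also have to like each other. -/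
def chosenTerm : Arith :=
  and (candidate (var 0)) (and (lt (count 2 (and (lt (var 2) (var 0)) (chosen (var 2)))) quota)
    (or (lt mode (const 2)) (all 2 (or (not (and (lt (var 2) (var 0)) (chosen (var 2))))
      (and (likes (var 0) (var 2)) (likes (var 2) (var 0)))))))

/-- The greedy choice of up to `q` leaves `var 1` for the star with centre `var 0`. -/
def leafTerm : Arith :=
  and (chosen (var 0)) (and (not (chosen (var 1))) (and (likes (var 0) (var 1))
    (and (not (ex 2 (and (lt (var 2) (var 0)) (leaf (var 2) (var 1)))))
      (lt (count 2 (and (lt (var 2) (var 1)) (leaf (var 0) (var 2)))) root))))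

/-- The label of the coalition of agent `var 0`. For medium degrees, the centre of a star and its
leaves are labelled by the number of the centre, increased by `1`; otherwise, the label `1` marks
the coalition of the chosen agents. All remaining agents share the label `0`. -/
def labelTerm : Arith :=
  ite (eq mode (const 0))
    (ite (chosen (var 0)) (add (var 0) (const 1))
      (sum 0 2 (ite (leaf (var 2) (var 0)) (add (var 2) (const 1)) (const 0))))
    (ite (ite (eq mode (const 1))
        (or (chosen (var 0)) (ex 2 (and (chosen (var 2)) (and (likes (var 2) (var 0))
          (not (ex 3 (and (lt (var 3) (var 0)) (likes (var 2) (var 3)))))))))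
        (all 2 (or (not (chosen (var 2))) (or (eq (var 2) (var 0)) (likes (var 2) (var 0))))))
      (const 1) (const 0))

/-- The tabulations of the computation program. -/
def stages : List (ℕ × Arith) :=
  [(3, rootTerm), (4, rootSqTerm), (5, quotaTerm), (6, degreeTerm), (7, modeTerm),
    (8, candidateTerm), (9, chosenTerm), (10, leafTerm), (2, labelTerm)]

/-- The computation program. -/
def program : Program := tabulateAll stages

theorem stages_wf : stages.all (fun x => decide (x.1 < 20 ∧ x.1 ≠ 0) && x.2.wf 2) = true := by
  decide

theorem stages_pairwise :
    stages.Pairwise fun x y => x.1 ≠ y.1 ∧ x.2.avoids y.1 = true := by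
  decide

end PartitionProgram

/-! ### The meaning of the computed arrays -/

/-- The integral part of the cube root. -/
def cbrt (n : ℕ) : ℕ := Nat.findGreatest (fun x => x ^ 3 ≤ n) n

theorem cbrt_pow_le (n : ℕ) : cbrt n ^ 3 ≤ n :=
  Nat.findGreatest_spec (P := fun x => x ^ 3 ≤ n) (Nat.zero_le n) (by simp)

theorem cbrt_le (n : ℕ) : cbrt n ≤ n := Nat.findGreatest_le n

theorem pow_le_iff_le_cbrt (n x : ℕ) : x ^ 3 ≤ n ↔ x ≤ cbrt n := by
  refine ⟨fun h => Nat.le_findGreatest ((Nat.le_self_pow (by norm_num) x).trans h) h, fun h => ?_⟩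
  exact (Nat.pow_le_pow_left h 3).trans (cbrt_pow_le n)

theorem lt_cbrt_add_one_pow (n : ℕ) : n < (cbrt n + 1) ^ 3 := by
  by_contra h
  have := (pow_le_iff_le_cbrt n _).1 (not_lt.1 h)
  omega

theorem Fin.card_filter_val_lt_of_le {n c : ℕ} (h : c ≤ n) :
    (Finset.univ.filter fun r : Fin n => (r : ℕ) < c).card = c := by
  rw [Finset.card_filter, ← Finset.sum_range (fun r => if r < c then 1 else 0),
    ← Finset.card_filter, show (Finset.range n).filter (· < c) = Finset.range c by ext; simp; omega,
    Finset.card_range]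

namespace PartitionProgram

open RAM Arith

variable {n : ℕ} {G : SimpleFHG n} {M : Memory} {ρ : ℕ → ℕ}

theorem eval_cubeTerm (hn : M 0 0 0 = n) {r : ℕ} (hr : ρ 2 = r) (hrn : r < n) :
    cubeTerm.eval M ρ = (r + 1) ^ 3 := by
  have hc : (Finset.univ.filter fun x : Fin n => (x : ℕ) ≤ r).card = r + 1 := by
    simp only [← Nat.lt_succ_iff]
    exact Fin.card_filter_val_lt_of_le hrn
  have hs : ∀ c : ℕ, (∑ x : Fin n, if (x : ℕ) ≤ r then c else 0) = (r + 1) * c := by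
    intro c
    rw [← Finset.sum_filter, Finset.sum_const, hc, smul_eq_mul]
  simp only [cubeTerm, eval_sum _ _ hn, eval_ite, holds_le, eval_count _ _ hn, eval_var,
    eval_const, Function.update_apply, hr]
  simp only [Nat.reduceEqDiff, if_true, if_false]
  rw [hc, hs, hs]
  ring

/-- In the memory `M`, the input and the arrays of parameters and degrees up to array `a` have their
intended contents. -/
structure HoldsUpTo (G : SimpleFHG n) (a : ℕ) (M : Memory) : Prop where
  agents : M 0 0 0 = n
  likes : ∀ i j : Fin n, M 1 i j ≠ 0 ↔ G.Adj i j
  root : 3 ≤ a → M 3 0 0 = cbrt n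
  rootSq : 4 ≤ a → M 4 0 0 = cbrt n ^ 2
  quota : 5 ≤ a → M 5 0 0 = cbrt n / 128
  degree : 6 ≤ a → ∀ i : Fin n, M 6 i 0 = G.deg i

theorem HoldsUpTo.congr {a : ℕ} {M' : Memory} (h : HoldsUpTo G a M)
    (hM : ∀ b < 7, M' b = M b) : HoldsUpTo G a M' where
  agents := by rw [hM 0 (by omega)]; exact h.agents
  likes := by rw [hM 1 (by omega)]; exact h.likes
  root := by rw [hM 3 (by omega)]; exact h.root
  rootSq := by rw [hM 4 (by omega)]; exact h.rootSq
  quota := by rw [hM 5 (by omega)]; exact h.quota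
  degree := by rw [hM 6 (by omega)]; exact h.degree

section

variable {a : ℕ} (h : HoldsUpTo G a M) {x y : Arith} {i j : Fin n}
include h

theorem eval_agents : agents.eval M ρ = n := h.agents

theorem holds_likes (hx : x.eval M ρ = i) (hy : y.eval M ρ = j) :
    (likes x y).Holds M ρ ↔ G.Adj i j := by
  rw [likes, holds_read, hx, hy, h.likes]

theorem eval_degree (ha : 6 ≤ a) (hx : x.eval M ρ = i) : (degree x).eval M ρ = G.deg i := by
  rw [degree, entry, eval_read, hx]
  exact h.degree ha i

theorem holds_medium (ha : 6 ≤ a) (hx : x.eval M ρ = i) :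
    (medium x).Holds M ρ ↔ G.Medium (cbrt n) i := by
  simp only [medium, holds_and, holds_le, eval_add, eval_double, eval_degree h ha hx,
    eval_agents h, rootSq, entry, eval_read, eval_const, h.rootSq (by omega), SimpleFHG.Medium]
  rw [← mul_assoc, show 2 * 2 = 4 from rfl]

theorem holds_low (ha : 6 ≤ a) (hx : x.eval M ρ = i) :
    (low x).Holds M ρ ↔ G.Low (cbrt n) i := by
  simp only [low, holds_and, holds_le, holds_lt, eval_degree h ha hx, rootSq, entry, eval_read,
    eval_const, h.rootSq (by omega), SimpleFHG.Low]

theorem holds_high (ha : 6 ≤ a) (hx : x.eval M ρ = i) :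
    (high x).Holds M ρ ↔ G.High (cbrt n) i := by
  simp only [high, holds_lt, eval_add, eval_double, eval_degree h ha hx,
    eval_agents h, rootSq, entry, eval_read, eval_const, h.rootSq (by omega), SimpleFHG.High]
  rw [← mul_assoc, show 2 * 2 = 4 from rfl]

end

section

variable {σ τ : Memory} (hn : 0 < n) (hτ : ∀ x ∈ stages, ∀ i < n, ∀ j < n,
  τ x.1 i j = x.2.eval (partialMemory x.1 σ τ i j) (env i j))
  (h0 : τ 0 0 0 = n) (h1 : ∀ i j : Fin n, τ 1 i j ≠ 0 ↔ G.Adj i j)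
include hn hτ h0 h1

theorem holdsUpTo_six : HoldsUpTo G 6 τ := by
  have e0 : HoldsUpTo G 0 τ := ⟨h0, h1, by omega, by omega, by omega, by omega⟩
  have e3 : τ 3 0 0 = cbrt n := by
    rw [hτ (3, rootTerm) (by simp [stages]) 0 hn 0 hn]
    have hM : partialMemory 3 σ τ 0 0 0 0 0 = n := by rw [partialMemory_of_ne (by omega), h0]
    simp only [rootTerm, eval_count _ _ hM, holds_le]
    rw [← Fin.card_filter_val_lt_of_le (cbrt_le n)]
    congr 1
    ext r
    simp only [Finset.mem_filter, Finset.mem_univ, true_and]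
    rw [eval_cubeTerm hM (by simp) r.2, agents, entry, eval_read, eval_const, hM,
      pow_le_iff_le_cbrt, Nat.succ_le_iff]
  have e4 : τ 4 0 0 = cbrt n ^ 2 := by
    rw [hτ (4, rootSqTerm) (by simp [stages]) 0 hn 0 hn]
    have hM : partialMemory 4 σ τ 0 0 0 0 0 = n := by rw [partialMemory_of_ne (by omega), h0]
    have hM3 : partialMemory 4 σ τ 0 0 3 0 0 = cbrt n := by
      rw [partialMemory_of_ne (by omega), e3]
    simp only [rootSqTerm, eval_sum _ _ hM, eval_ite, holds_lt, root, entry, eval_read, eval_const,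
      eval_var, hM3, Function.update_self]
    rw [← Finset.sum_filter, Finset.sum_const, Fin.card_filter_val_lt_of_le (cbrt_le n),
      smul_eq_mul, sq]
  have e5 : τ 5 0 0 = cbrt n / 128 := by
    rw [hτ (5, quotaTerm) (by simp [stages]) 0 hn 0 hn]
    have hM : partialMemory 5 σ τ 0 0 0 0 0 = n := by rw [partialMemory_of_ne (by omega), h0]
    have hM3 : partialMemory 5 σ τ 0 0 3 0 0 = cbrt n := by
      rw [partialMemory_of_ne (by omega), e3]
    simp only [quotaTerm, eval_count _ _ hM, holds_le, eval_double, root, entry, eval_read,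
      eval_const, eval_var, eval_add, hM3, Function.update_self]
    rw [← Fin.card_filter_val_lt_of_le ((Nat.div_le_self _ 128).trans (cbrt_le n))]
    congr 1
    ext r
    simp only [Finset.mem_filter, Finset.mem_univ, true_and]
    omega
  refine ⟨h0, h1, fun _ => e3, fun _ => e4, fun _ => e5, fun _ i => ?_⟩
  rw [hτ (6, degreeTerm) (by simp [stages]) i i.2 0 hn]
  have hM : HoldsUpTo G 0 (partialMemory 6 σ τ i 0) := by
    refine ⟨?_, ?_, by omega, by omega, by omega, by omega⟩
    · rw [partialMemory_of_ne (by omega), h0]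
    · rw [partialMemory_of_ne (by omega)]
      exact h1
  simp only [degreeTerm, eval_count _ _ hM.agents, SimpleFHG.deg, SimpleFHG.nbrs]
  congr 1
  ext j
  simp only [Finset.mem_filter, Finset.mem_univ, true_and]
  exact holds_likes hM (by simp [eval_var, env_zero]) (by simp [eval_var])

/-- The arrays of degrees and parameters have their intended contents also at all times when the
later arrays are tabulated. -/
theorem holdsUpTo_partialMemory {A : ℕ} (hA : 7 ≤ A) (i j : ℕ) :
    HoldsUpTo G 6 (partialMemory A σ τ i j) :=
  (holdsUpTo_six hn hτ h0 h1).congr fun b hb => partialMemory_of_ne (by omega) _ _ _ _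

theorem mode_eq : τ 7 0 0 =
    if cbrt n / 128 ≤ (Finset.univ.filter (G.Medium (cbrt n))).card then 0 else
      if cbrt n / 128 ≤ (Finset.univ.filter (G.Low (cbrt n))).card then 1 else 2 := by
  have hM := holdsUpTo_partialMemory hn hτ h0 h1 (A := 7) le_rfl 0 0
  rw [hτ (7, modeTerm) (by simp [stages]) 0 hn 0 hn]
  simp only [modeTerm, eval_ite, holds_le, eval_count _ _ hM.agents, quota, entry, eval_read,
    eval_const, hM.quota (by omega)]
  have e1 : ∀ k : Fin n, (medium (var 2)).Holds (partialMemory 7 σ τ 0 0)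
      (Function.update (env 0 0) 2 k) ↔ G.Medium (cbrt n) k := fun k =>
    holds_medium hM le_rfl (by simp [eval_var])
  have e2 : ∀ k : Fin n, (low (var 2)).Holds (partialMemory 7 σ τ 0 0)
      (Function.update (env 0 0) 2 k) ↔ G.Low (cbrt n) k := fun k =>
    holds_low hM le_rfl (by simp [eval_var])
  simp only [e1, e2]

theorem candidate_iff (i : Fin n) : τ 8 i 0 ≠ 0 ↔
    if τ 7 0 0 = 0 then G.Medium (cbrt n) i else if τ 7 0 0 = 1 then G.Low (cbrt n) i else
      G.Good (cbrt n) i := by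
  have hM := holdsUpTo_partialMemory hn hτ h0 h1 (A := 8) (by omega) i 0
  have h7 : partialMemory 8 σ τ i 0 7 = τ 7 := partialMemory_of_ne (by omega) _ _ _ _
  rw [hτ (8, candidateTerm) (by simp [stages]) i i.2 0 hn]
  simp only [candidateTerm, eval_ite, holds_eq, mode, entry, eval_read, eval_const, h7]
  have hx : (var 0).eval (partialMemory 8 σ τ i 0) (env i 0) = i := rfl
  split_ifs
  · exact holds_medium hM le_rfl hx
  · exact holds_low hM le_rfl hx
  · change Holds _ _ _ ↔ _
    rw [holds_and, holds_high hM le_rfl hx, SimpleFHG.Good, holds_le, eval_count _ _ hM.agents]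
    have e : ∀ k : Fin n, (and (high (var 2)) (not (likes (var 2) (var 0)))).Holds
        (partialMemory 8 σ τ i 0) (Function.update (env i 0) 2 k) ↔
        G.High (cbrt n) k ∧ ¬ G.Adj k i := by
      intro k
      rw [holds_and, holds_not, holds_high hM le_rfl (i := k) (by simp [eval_var]),
        holds_likes hM (i := k) (j := i) (by simp [eval_var]) (by simp [eval_var, env_zero])]
    simp only [e, eval_double, rootSq, entry, eval_read, eval_const, hM.rootSq (by omega)]
    rw [← mul_assoc, ← mul_assoc, show 2 * 2 * 2 = 8 from rfl]

theorem chosen_iff (i : Fin n) : τ 9 i 0 ≠ 0 ↔ τ 8 i 0 ≠ 0 ∧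
    (Finset.univ.filter fun j : Fin n => j < i ∧ τ 9 j 0 ≠ 0).card < cbrt n / 128 ∧
    (τ 7 0 0 < 2 ∨ ∀ j < i, τ 9 j 0 ≠ 0 → G.Adj i j ∧ G.Adj j i) := by
  have hM := holdsUpTo_partialMemory hn hτ h0 h1 (A := 9) (by omega) i 0
  have h7 : partialMemory 9 σ τ i 0 7 = τ 7 := partialMemory_of_ne (by omega) _ _ _ _
  have h8 : partialMemory 9 σ τ i 0 8 = τ 8 := partialMemory_of_ne (by omega) _ _ _ _
  have h9 : ∀ j : Fin n, (and (lt (var 2) (var 0)) (chosen (var 2))).Holds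
      (partialMemory 9 σ τ i 0) (Function.update (env i 0) 2 j) ↔ j < i ∧ τ 9 j 0 ≠ 0 := by
    intro j
    simp only [holds_and, holds_lt, chosen, entry, holds_read, eval_var, eval_const,
      Function.update_self, ne_eq, OfNat.zero_ne_ofNat, not_false_eq_true,
      Function.update_of_ne, env_zero, Fin.lt_def]
    refine and_congr_right fun hlt => ?_
    rw [partialMemory_of_lt (Or.inl hlt)]
  have hadj : ∀ j : Fin n, (and (likes (var 0) (var 2)) (likes (var 2) (var 0))).Holds
      (partialMemory 9 σ τ i 0) (Function.update (env i 0) 2 j) ↔ G.Adj i j ∧ G.Adj j i := by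
    intro j
    rw [holds_and, holds_likes hM (i := i) (j := j) (by simp [eval_var, env_zero])
      (by simp [eval_var]), holds_likes hM (i := j) (j := i) (by simp [eval_var])
      (by simp [eval_var, env_zero])]
  conv_lhs => rw [hτ (9, chosenTerm) (by simp [stages]) i i.2 0 hn]
  change Holds _ _ _ ↔ _
  simp only [chosenTerm, holds_and, holds_lt, holds_or, holds_not, holds_all _ _ hM.agents,
    eval_count _ _ hM.agents, hadj]
  simp only [← holds_lt, ← holds_and, h9]
  simp only [candidate, mode, quota, entry, holds_read, eval_read, eval_var, eval_const, h7, h8,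
    hM.quota (by omega), env_zero, holds_lt]
  refine and_congr_right fun _ => and_congr_right fun _ => or_congr_right ?_
  refine forall_congr' fun j => ?_
  rw [← imp_iff_not_or, and_imp]

theorem leaf_iff (i j : Fin n) : τ 10 i j ≠ 0 ↔ τ 9 i 0 ≠ 0 ∧ ¬ τ 9 j 0 ≠ 0 ∧ G.Adj i j ∧
    (∀ i' < i, ¬ τ 10 i' j ≠ 0) ∧
    (Finset.univ.filter fun j' : Fin n => j' < j ∧ τ 10 i j' ≠ 0).card < cbrt n := by
  have hM := holdsUpTo_partialMemory hn hτ h0 h1 (A := 10) (by omega) i j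
  have h9 : partialMemory 10 σ τ i j 9 = τ 9 := partialMemory_of_ne (by omega) _ _ _ _
  have ha : ∀ i' : Fin n, (and (lt (var 2) (var 0)) (leaf (var 2) (var 1))).Holds
      (partialMemory 10 σ τ i j) (Function.update (env i j) 2 i') ↔ i' < i ∧ τ 10 i' j ≠ 0 := by
    intro i'
    simp only [holds_and, holds_lt, leaf, holds_read, eval_var, Function.update_self, ne_eq,
      OfNat.zero_ne_ofNat, OfNat.one_ne_ofNat, not_false_eq_true, Function.update_of_ne,
      env_zero, env_one, Fin.lt_def]
    refine and_congr_right fun hlt => ?_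
    rw [partialMemory_of_lt (Or.inl hlt)]
  have hb : ∀ j' : Fin n, (and (lt (var 2) (var 1)) (leaf (var 0) (var 2))).Holds
      (partialMemory 10 σ τ i j) (Function.update (env i j) 2 j') ↔ j' < j ∧ τ 10 i j' ≠ 0 := by
    intro j'
    simp only [holds_and, holds_lt, leaf, holds_read, eval_var, Function.update_self, ne_eq,
      OfNat.zero_ne_ofNat, OfNat.one_ne_ofNat, not_false_eq_true, Function.update_of_ne,
      env_zero, env_one, Fin.lt_def]
    refine and_congr_right fun hlt => ?_
    rw [partialMemory_of_lt (Or.inr ⟨rfl, hlt⟩)]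
  conv_lhs => rw [hτ (10, leafTerm) (by simp [stages]) i i.2 j j.2]
  change Holds _ _ _ ↔ _
  rw [leafTerm, holds_and, holds_and, holds_and, holds_and, holds_not, holds_not,
    holds_ex _ _ hM.agents, holds_lt, eval_count _ _ hM.agents,
    holds_likes hM (i := i) (j := j) rfl rfl]
  simp only [ha, hb, chosen, root, entry, holds_read, eval_read, eval_var, eval_const, h9,
    hM.root (by omega), env_zero, env_one]
  push Not
  rfl

theorem label_eq (j : Fin n) : τ 2 j 0 =
    if τ 7 0 0 = 0 then
      if τ 9 j 0 ≠ 0 then (j : ℕ) + 1 else ∑ i : Fin n, if τ 10 i j ≠ 0 then (i : ℕ) + 1 else 0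
    else if (if τ 7 0 0 = 1 then τ 9 j 0 ≠ 0 ∨
        ∃ i : Fin n, τ 9 i 0 ≠ 0 ∧ G.Adj i j ∧ ∀ j' < j, ¬ G.Adj i j'
      else ∀ i : Fin n, τ 9 i 0 ≠ 0 → i = j ∨ G.Adj i j) then 1 else 0 := by
  have hM : HoldsUpTo G 6 (partialMemory 2 σ τ j 0) := by
    have h6 := holdsUpTo_six hn hτ h0 h1
    have hne : ∀ b, b ≠ 2 → partialMemory 2 σ τ j 0 b = τ b := fun b hb =>
      partialMemory_of_ne hb _ _ _ _
    refine ⟨?_, ?_, ?_, ?_, ?_, ?_⟩ <;> rw [hne _ (by omega)]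
    exacts [h6.agents, h6.likes, h6.root, h6.rootSq, h6.quota, h6.degree]
  have h7 : partialMemory 2 σ τ j 0 7 = τ 7 := partialMemory_of_ne (by omega) _ _ _ _
  have h9 : partialMemory 2 σ τ j 0 9 = τ 9 := partialMemory_of_ne (by omega) _ _ _ _
  have h10 : partialMemory 2 σ τ j 0 10 = τ 10 := partialMemory_of_ne (by omega) _ _ _ _
  have hadj : ∀ i : Fin n, (likes (var 2) (var 0)).Holds (partialMemory 2 σ τ j 0)
      (Function.update (env j 0) 2 i) ↔ G.Adj i j := fun i =>
    holds_likes hM (by simp [eval_var]) (by simp [eval_var, env_zero])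
  have hadj' : ∀ i j' : Fin n, (likes (var 2) (var 3)).Holds (partialMemory 2 σ τ j 0)
      (Function.update (Function.update (env j 0) 2 i) 3 j') ↔ G.Adj i j' := fun i j' =>
    holds_likes hM (by simp [eval_var]) (by simp [eval_var])
  have hlt : ∀ i j' : Fin n, (lt (var 3) (var 0)).Holds (partialMemory 2 σ τ j 0)
      (Function.update (Function.update (env j 0) 2 i) 3 j') ↔ j' < j := fun i j' => by
    simp [holds_lt, eval_var, env_zero]
  rw [hτ (2, labelTerm) (by simp [stages]) j j.2 0 hn]
  simp only [labelTerm, eval_ite, holds_ite, holds_eq, eval_sum _ _ hM.agents, holds_or,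
    holds_all _ _ hM.agents, holds_not, hadj]
  simp only [holds_ex _ _ hM.agents, holds_and, holds_not, hadj, hadj', hlt]
  simp only [mode, leaf, chosen, entry, holds_read, eval_read, eval_const, eval_add, eval_var,
    h7, h9, h10, env_zero, Function.update_self, ne_eq, OfNat.zero_ne_ofNat,
    not_false_eq_true, Function.update_of_ne, Fin.val_inj]
  simp only [← imp_iff_not_or, not_exists, not_and]

end

end PartitionProgram

/-! ### Correctness of the computation program -/

namespace PartitionProgram

open RAM Arith SimpleFHG

variable {n : ℕ} {G : SimpleFHG n}

/-- The labels computed by the program make a number of agents content that is proportional to the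
cube root of `n`. -/
theorem exists_content {σ τ : Memory} (hn : 0 < n) (hτ : ∀ x ∈ stages, ∀ i < n, ∀ j < n,
    τ x.1 i j = x.2.eval (partialMemory x.1 σ τ i j) (env i j))
    (h0 : τ 0 0 0 = n) (h1 : ∀ i j : Fin n, τ 1 i j ≠ 0 ↔ G.Adj i j) (hq : 2 ≤ cbrt n) :
    ∃ H : Finset (Fin n), cbrt n / 128 ≤ H.card ∧ ∀ i ∈ H,
      G.Content (cbrt n) (Finset.univ.filter fun j : Fin n => τ 2 j 0 = τ 2 i 0) i := by
  have hmode := mode_eq hn hτ h0 h1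
  have hcand := candidate_iff hn hτ h0 h1
  have hchosen := chosen_iff hn hτ h0 h1
  have hleaf := leaf_iff hn hτ h0 h1
  have hlabel := label_eq hn hτ h0 h1
  have hlow := cbrt_pow_le n
  have hup := lt_cbrt_add_one_pow n
  set q := cbrt n with hqdef
  set k := q / 128 with hkdef
  set H : Finset (Fin n) := Finset.univ.filter fun i => τ 9 i 0 ≠ 0 with hH
  have hmem : ∀ i : Fin n, τ 9 i 0 ≠ 0 ↔ i ∈ H := by simp [hH]
  have hHk : H.card ≤ k := card_le_of_greedy fun i hi => ((hchosen i).1 hi).2.1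
  have hk : 128 * H.card ≤ q := by omega
  simp only [hmem] at hchosen hleaf hlabel
  -- Without conflicts between candidates, the greedy choice takes all it may.
  have hfull : τ 7 0 0 < 2 → ∀ P : Fin n → Prop, ∀ [DecidablePred P],
      (∀ i : Fin n, τ 8 i 0 ≠ 0 ↔ P i) → k ≤ (Finset.univ.filter P).card → k ≤ H.card := by
    intro h7 P _ hP hle
    by_contra hlt
    refine hlt (hle.trans (Finset.card_le_card fun i hi => (hchosen i).2 ⟨?_, ?_, Or.inl h7⟩))
    · exact (hP i).2 (Finset.mem_filter.1 hi).2
    · refine (card_filter_lt_le i).trans_lt ?_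
      rw [show Finset.univ.filter (· ∈ H) = H by simp]
      omega
  by_cases hmed : k ≤ (Finset.univ.filter (G.Medium q)).card
  · rw [if_pos hmed] at hmode
    simp only [hmode, if_true] at hcand hlabel hfull
    refine ⟨H, hfull (by norm_num) _ hcand hmed, content_of_stars (leaf := fun i j => τ 10 i j ≠ 0)
      hq hup (fun i hi => (hcand i).1 ((hchosen i).1 hi).1) ?_ hleaf (fun j hj => ?_) ?_ ?_⟩
    · nlinarith
    · rw [hlabel, if_pos hj]
    · intro i j hij
      have hi := (hleaf i j).1 hij
      rw [hlabel, if_neg hi.2.1, Finset.sum_eq_single i, if_pos hij]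
      · intro i' _ hne
        rw [if_neg]
        intro hij'
        rcases lt_or_gt_of_ne hne with h | h
        · exact hi.2.2.2.1 i' h hij'
        · exact ((hleaf i' j).1 hij').2.2.2.1 i h hij
      · simp
    · intro j hj hnone
      rw [hlabel, if_neg hj]
      exact Finset.sum_eq_zero fun i _ => if_neg (hnone i)
  · rw [if_neg hmed] at hmode
    by_cases hlo : k ≤ (Finset.univ.filter (G.Low q)).card
    · rw [if_pos hlo] at hmode
      simp only [hmode, one_ne_zero, if_false, if_true] at hcand hlabel hfull
      refine ⟨H, hfull (by norm_num) _ hcand hlo, content_of_choice hq hlow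
        (fun i hi => (hcand i).1 ((hchosen i).1 hi).1) hk fun j => ?_⟩
      rw [hlabel]
      split_ifs with h
      · exact iff_of_true rfl h
      · exact iff_of_false id h
    · rw [if_neg hlo] at hmode
      simp only [hmode, OfNat.ofNat_ne_zero, OfNat.ofNat_ne_one, if_false, lt_self_iff_false,
        false_or] at hcand hlabel hchosen
      by_cases hzero : k ≤ (Finset.univ.filter fun i => G.deg i = 0).card
      · exact ⟨_, hzero, fun i hi => content_of_deg_eq_zero (Finset.mem_filter.1 hi).2⟩
      · simp only [hcand] at hchosen
        refine ⟨H, card_greedy_clique hq hlow (by omega) hchosen (not_le.1 hzero) (not_le.1 hlo)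
          (not_le.1 hmed), content_of_clique hq hlow (fun i hi => ((hchosen i).1 hi).1.1) hk ?_
          fun j => ?_⟩
        · intro i hi j hj
          rcases lt_trichotomy i j with h | h | h
          · exact Or.inr (((hchosen j).1 hj).2.2 i h hi).2
          · exact Or.inl h
          · exact Or.inr (((hchosen i).1 hi).2.2 j h hj).1
        · rw [hlabel]
          split_ifs with h
          · exact iff_of_true rfl h
          · exact iff_of_false id h

/-- The computation program halts in polynomial time, with a partition that makes many agents
content. -/
theorem exists_computesWithin (G : SimpleFHG n) :
    ∃ π : Finpartition (Finset.univ : Finset (Fin n)),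
      G.ComputesWithin program ((tabulateAllCost stages).eval n) π ∧
      (2 ≤ cbrt n → ∃ H : Finset (Fin n), cbrt n / 128 ≤ H.card ∧
        ∀ i ∈ H, G.Content (cbrt n) (π.part i) i) := by
  have hin0 : G.graphInput 0 0 0 = n := rfl
  have hin1 : ∀ i j : Fin n, G.graphInput 1 i j ≠ 0 ↔ G.Adj i j := by
    intro i j
    have : G.graphInput 1 i j = (G.weight i j).num.toNat := by simp [graphInput]
    rw [this, G.weight_eq]
    split_ifs with h <;> simp [h]
  obtain ⟨T, τ, hT, hrun, htab⟩ := run_tabulateAll stages stages_wf G.graphInput n le_rfl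
  rw [hin0] at htab
  have hwf : ∀ x ∈ stages, (x.1 < 20 ∧ x.1 ≠ 0) ∧ x.2.wf 2 = true := by
    simpa only [List.all_eq_true, Bool.and_eq_true, decide_eq_true_eq] using stages_wf
  have hspec := htab.spec (List.all_eq_true.2 fun x hx => decide_eq_true (hwf x hx).1.1)
    stages_pairwise fun x hx a ha => Arith.avoids_of_wf (hwf x hx).2 ha
  have h0 : τ 0 = G.graphInput 0 := htab.frame 0 (by norm_num) (by decide)
  have h1 : τ 1 = G.graphInput 1 := htab.frame 1 (by norm_num) (by decide)
  classical
  let s : Setoid (Fin n) := Setoid.ker fun i : Fin n => τ 2 i 0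
  have hpart : ∀ i j : Fin n, j ∈ (Finpartition.ofSetoid s).part i ↔ τ 2 i 0 = τ 2 j 0 :=
    fun i j => Finpartition.mem_part_ofSetoid_iff_rel
  refine ⟨Finpartition.ofSetoid s, ⟨T, hT, τ, hrun, fun i j => ?_⟩, fun hq => ?_⟩
  · rw [← hpart, eq_comm]
    exact Finpartition.mem_part_iff_part_eq_part _ (Finset.mem_univ _) (Finset.mem_univ _)
  · have hn : 0 < n := by
      have := cbrt_le n
      omega
    obtain ⟨H, hcard, hcontent⟩ := exists_content (G := G) hn hspec (by rw [h0, hin0])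
      (by rw [h1]; exact hin1) hq
    refine ⟨H, hcard, fun i hi => ?_⟩
    have : (Finpartition.ofSetoid s).part i =
        Finset.univ.filter fun j : Fin n => τ 2 j 0 = τ 2 i 0 := by
      ext j
      rw [hpart, Finset.mem_filter, eq_comm]
      simp
    rw [this]
    exact hcontent i hi

end PartitionProgram

/-! ### The fraction of blocking coalitions -/

namespace SimpleFHG

variable {n : ℕ} {G : SimpleFHG n}

theorem sum_indicator_mul_signOf (N S : Finset (Fin n)) :
    ∑ j, (if j ∈ N then (1 : ℝ) else 0) * signOf S j = 2 * (S ∩ N).card - N.card := by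
  simp only [ite_mul, one_mul, zero_mul, Finset.sum_ite_mem, Finset.univ_inter]
  have h : ∀ j, signOf S j = 2 * (if j ∈ S then 1 else 0) - 1 := by
    intro j
    unfold signOf
    split_ifs <;> norm_num
  simp only [h, Finset.sum_sub_distrib, ← Finset.mul_sum, Finset.sum_boole, Finset.sum_const,
    nsmul_eq_mul, mul_one]
  rw [Finset.filter_mem_eq_inter, Finset.inter_comm]

/-- Almost all sets are typical. -/
theorem card_not_typical_le (G : SimpleFHG n) (q : ℕ) :
    (({S | ¬ G.Typical q S} : Set (Finset (Fin n))).ncard : ℝ) ≤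
      2 ^ n * ((n + 2) * Real.exp (-(q ^ 4 / (2 * n)))) := by
  classical
  have hq : (0 : ℝ) ≤ (q : ℝ) ^ 2 := by positivity
  have htail : ∀ c : Fin n → ℝ, (∀ j, |c j| ≤ 1) →
      ((Finset.univ.filter fun S : Finset (Fin n) => (q : ℝ) ^ 2 < ∑ j, c j * signOf S j).card : ℝ)
        ≤ 2 ^ n * Real.exp (-(q ^ 4 / (2 * n))) := by
    intro c hc
    have := card_sum_signs_gt c hc hq
    rwa [Fintype.card_fin, ← pow_mul] at this
  set A : Finset (Finset (Fin n)) := Finset.univ.filter fun S =>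
    (q : ℝ) ^ 2 < ∑ j : Fin n, -1 * signOf S j
  set B : Finset (Finset (Fin n)) := Finset.univ.filter fun S =>
    (q : ℝ) ^ 2 < ∑ j : Fin n, 1 * signOf S j
  set C : Fin n → Finset (Finset (Fin n)) := fun i => Finset.univ.filter fun S =>
    (q : ℝ) ^ 2 < ∑ j, (if j ∈ G.nbrs i then (1 : ℝ) else 0) * signOf S j
  have hsize : ∀ S : Finset (Fin n), ∑ j : Fin n, 1 * signOf S j = 2 * S.card - n := by
    intro S
    have := sum_indicator_mul_signOf Finset.univ S
    simpa using this
  have hsub : ({S | ¬ G.Typical q S} : Set (Finset (Fin n))) ⊆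
      (A ∪ B ∪ Finset.univ.biUnion C : Finset (Finset (Fin n))) := by
    intro S hS
    by_contra hcon
    simp only [Finset.coe_union, Finset.coe_biUnion, Set.mem_union, Finset.mem_coe, not_or,
      Set.mem_iUnion, not_exists, Finset.mem_univ, true_and, A, B, C, Finset.mem_filter, not_lt,
      neg_mul, Finset.sum_neg_distrib, hsize, sum_indicator_mul_signOf, Finset.coe_univ,
      Set.mem_univ, exists_prop] at hcon
    obtain ⟨⟨hA, hB⟩, hC⟩ := hcon
    refine hS ⟨?_, ?_, fun i => ?_⟩
    · have : (n : ℝ) ≤ 2 * S.card + q ^ 2 := by linarith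
      exact_mod_cast this
    · have : (2 : ℝ) * S.card ≤ n + q ^ 2 := by linarith
      exact_mod_cast this
    · have : (2 : ℝ) * (S ∩ G.nbrs i).card ≤ (G.nbrs i).card + q ^ 2 := by linarith [hC i]
      exact_mod_cast this
  have hcard : ({S | ¬ G.Typical q S} : Set (Finset (Fin n))).ncard ≤
      A.card + B.card + ∑ i, (C i).card := by
    refine (Set.ncard_le_ncard hsub (Finset.finite_toSet _)).trans ?_
    rw [Set.ncard_coe_finset]
    refine (Finset.card_union_le _ _).trans ?_
    exact add_le_add (Finset.card_union_le _ _) Finset.card_biUnion_le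
  have hcard' : (({S | ¬ G.Typical q S} : Set (Finset (Fin n))).ncard : ℝ) ≤
      A.card + B.card + ∑ i, ((C i).card : ℝ) := by exact_mod_cast hcard
  refine hcard'.trans ?_
  have hA := htail (fun _ => -1) (by simp)
  have hB := htail (fun _ => 1) (by simp)
  have hC : ∑ i, ((C i).card : ℝ) ≤ ∑ _i : Fin n, 2 ^ n * Real.exp (-(q ^ 4 / (2 * n))) := by
    refine Finset.sum_le_sum fun i _ => htail _ fun j => ?_
    split_ifs <;> simp
  rw [Finset.sum_const, Finset.card_univ, Fintype.card_fin, nsmul_eq_mul] at hC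
  linarith

theorem card_disjoint_le {k : ℕ} {H : Finset (Fin n)} (hk : k ≤ H.card) :
    (({S | Disjoint S H} : Set (Finset (Fin n))).ncard : ℝ) ≤ 2 ^ n * (1 / 2) ^ k := by
  have h : ({S | Disjoint S H} : Set (Finset (Fin n))) = (Hᶜ.powerset : Finset _) := by
    ext S
    rw [Set.mem_ofPred_eq, Finset.mem_coe, Finset.mem_powerset,
      Finset.subset_compl_iff_disjoint_right]
  have hH : H.card ≤ n := by simpa using Finset.card_le_univ H
  have hle : n - H.card + k ≤ n := by omega
  rw [h, Set.ncard_coe_finset, Finset.card_powerset, Finset.card_compl, Fintype.card_fin]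
  push_cast
  rw [one_div, inv_pow, ← div_eq_mul_inv, le_div_iff₀ (by positivity), ← pow_add]
  exact pow_le_pow_right₀ (by norm_num) hle

theorem ncard_nonempty (n : ℕ) :
    (({S | S.Nonempty} : Set (Finset (Fin n))).ncard : ℝ) = 2 ^ n - 1 := by
  have h : ({S | S.Nonempty} : Set (Finset (Fin n))) = {∅}ᶜ := by
    ext S
    simp [Finset.nonempty_iff_ne_empty]
  have h' := Set.ncard_add_ncard_compl ({∅} : Set (Finset (Fin n)))
  rw [Set.ncard_singleton, Nat.card_eq_fintype_card, Fintype.card_finset, Fintype.card_fin] at h'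
  rw [h, eq_sub_iff_add_eq, add_comm]
  exact_mod_cast h'

/-- A blocking coalition is atypical or contains no content agent. -/
theorem ncard_coreBlocks_le {q k : ℕ} {π : Finpartition (Finset.univ : Finset (Fin n))}
    {H : Finset (Fin n)} (hk : k ≤ H.card) (hH : ∀ i ∈ H, G.Content q (π.part i) i) :
    (({S | G.CoreBlocks π S} : Set (Finset (Fin n))).ncard : ℝ) ≤
      2 ^ n * ((n + 2) * Real.exp (-(q ^ 4 / (2 * n))) + (1 / 2) ^ k) := by
  have hsub : ({S | G.CoreBlocks π S} : Set (Finset (Fin n))) ⊆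
      {S | ¬ G.Typical q S} ∪ {S | Disjoint S H} := by
    intro S hS
    by_cases hd : Disjoint S H
    · exact Or.inr hd
    · obtain ⟨i, hiS, hiH⟩ := Finset.not_disjoint_iff.1 hd
      exact Or.inl fun ht => (hS.2 i hiS).not_ge (hH i hiH S ht hiS)
  have h := (Set.ncard_le_ncard hsub (Set.toFinite _)).trans (Set.ncard_union_le _ _)
  have h' : (({S | G.CoreBlocks π S} : Set (Finset (Fin n))).ncard : ℝ) ≤
      (({S | ¬ G.Typical q S} : Set (Finset (Fin n))).ncard : ℝ) +
      (({S | Disjoint S H} : Set (Finset (Fin n))).ncard : ℝ) := by exact_mod_cast h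
  have h1 := G.card_not_typical_le q
  have h2 := card_disjoint_le hk
  linarith

/-- No partition is blocked by a coalition with only one member. -/
theorem coreBlocks_fraction_le (hn : 0 < n) (π : Finpartition (Finset.univ : Finset (Fin n))) :
    (({S | G.CoreBlocks π S} : Set (Finset (Fin n))).ncard : ℝ) /
      (({S | S.Nonempty} : Set (Finset (Fin n))).ncard : ℝ) ≤ 1 - (1 / 2) ^ n := by
  have hns : ¬ G.CoreBlocks π {⟨0, hn⟩} := by
    intro h
    have h0 := h.2 ⟨0, hn⟩ (Finset.mem_singleton_self _)
    have h1 : G.value ⟨0, hn⟩ {⟨0, hn⟩} = 0 := by simp [value, G.weight_self]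
    rw [h1, value_eq] at h0
    exact absurd h0 (not_lt.2 (by positivity))
  have hsub : ({S | G.CoreBlocks π S} : Set (Finset (Fin n))) ⊂ {S | S.Nonempty} :=
    (Set.ssubset_iff_of_subset fun S hS => hS.1).2
      ⟨{⟨0, hn⟩}, Finset.singleton_nonempty _, hns⟩
  have hlt := Set.ncard_lt_ncard hsub (Set.toFinite _)
  have hlt' : (({S | G.CoreBlocks π S} : Set (Finset (Fin n))).ncard : ℝ) + 1 ≤
      (({S | S.Nonempty} : Set (Finset (Fin n))).ncard : ℝ) := by exact_mod_cast hlt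
  rw [ncard_nonempty] at hlt' ⊢
  have h2 : (2 : ℝ) ≤ 2 ^ n := by
    simpa using pow_le_pow_right₀ (by norm_num : (1 : ℝ) ≤ 2) hn
  rw [div_le_iff₀ (by linarith)]
  have h3 : (1 / 2 : ℝ) ^ n * 2 ^ n = 1 := by rw [← mul_pow]; norm_num
  have h4 : (0 : ℝ) < (1 / 2) ^ n := by positivity
  nlinarith

end SimpleFHG

/-- The bound for the fraction of blocking coalitions, in terms of the cube root of `n`, is
eventually smaller than the required `2 ^ (-(q + 1) / 256)`. -/
theorem eventually_bound_lt : ∃ q₀ : ℕ, 2 ≤ q₀ ∧ ∀ q ≥ q₀,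
    2 * (((q + 1 : ℝ) ^ 3 + 2) * Real.exp (-(q / 16)) + (1 / 2 : ℝ) ^ (q / 128)) <
      (2 : ℝ) ^ (-((q + 1 : ℝ) / 256)) := by
  set r : ℝ := 2 ^ (-(1 / 256 : ℝ)) with hr
  have hr0 : 0 < r := by positivity
  have hr1 : r < 1 := Real.rpow_lt_one_of_one_lt_of_neg (by norm_num) (by norm_num)
  have hrq : ∀ q : ℕ, (r ^ q : ℝ) = 2 ^ (-((q : ℝ) / 256)) := by
    intro q
    rw [hr, ← Real.rpow_natCast, ← Real.rpow_mul (by norm_num)]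
    congr 1
    ring
  have hlim : Filter.Tendsto (fun q : ℕ => 2 * (40 * ((q : ℝ) ^ 3 * r ^ q)) ) Filter.atTop
      (nhds (2 * (40 * 0))) :=
    ((tendsto_pow_const_mul_const_pow_of_lt_one 3 hr0.le hr1).const_mul 40).const_mul 2
  rw [mul_zero, mul_zero] at hlim
  obtain ⟨N, hN⟩ := Filter.eventually_atTop.1 (hlim.eventually (gt_mem_nhds hr0))
  refine ⟨max N 2, le_max_right _ _, fun q hq => ?_⟩
  have hq2 : (2 : ℝ) ≤ q := by exact_mod_cast (le_max_right _ _).trans hq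
  have hlt := hN q ((le_max_left _ _).trans hq)
  have hpos : 0 < r ^ q := by positivity
  have h1 : Real.exp (-(q / 16 : ℝ)) ≤ r ^ q * r ^ q := by
    rw [← pow_add, hrq, Real.rpow_def_of_pos (by norm_num)]
    refine Real.exp_le_exp.2 ?_
    push_cast
    have := Real.log_two_lt_d9
    nlinarith
  have h2 : (1 / 2 : ℝ) ^ (q / 128) ≤ 2 * (r ^ q * r ^ q) := by
    rw [← pow_add, hrq, one_div, inv_pow, ← Real.rpow_natCast, ← Real.rpow_neg (by norm_num)]
    calc (2 : ℝ) ^ (-((q / 128 : ℕ) : ℝ)) ≤ 2 ^ (1 + -(((q + q : ℕ) : ℝ) / 256)) := by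
          refine Real.rpow_le_rpow_of_exponent_le (by norm_num) ?_
          have : (q : ℝ) < 128 * ((q / 128 : ℕ) : ℝ) + 128 := by
            exact_mod_cast (by omega : q < 128 * (q / 128) + 128)
          push_cast
          linarith
      _ = _ := by rw [Real.rpow_add (by norm_num), Real.rpow_one]
  have h3 : ((q + 1 : ℝ) ^ 3 + 2) + 2 ≤ 40 * (q : ℝ) ^ 3 := by
    have : (q + 1 : ℝ) ≤ 2 * q := by linarith
    have h := pow_le_pow_left₀ (by linarith) this 3
    have h8 : (2 : ℝ) ^ 3 ≤ q ^ 3 := pow_le_pow_left₀ (by norm_num) hq2 3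
    nlinarith
  have h4 : (2 : ℝ) ^ (-((q + 1 : ℝ) / 256)) = r ^ q * r := by
    rw [← pow_succ, hrq]
    push_cast
    rfl
  rw [h4]
  calc 2 * (((q + 1 : ℝ) ^ 3 + 2) * Real.exp (-(q / 16)) + (1 / 2 : ℝ) ^ (q / 128))
      ≤ 2 * (((q + 1 : ℝ) ^ 3 + 2) * (r ^ q * r ^ q) + 2 * (r ^ q * r ^ q)) := by gcongr
    _ = 2 * ((((q + 1 : ℝ) ^ 3 + 2) + 2) * (r ^ q * r ^ q)) := by ring
    _ ≤ 2 * (40 * (q : ℝ) ^ 3 * (r ^ q * r ^ q)) := by gcongr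
    _ = r ^ q * (2 * (40 * (q ^ 3 * r ^ q))) := by ring
    _ < r ^ q * r := by gcongr

namespace SimpleFHG

/-- Partitions with many content agents are stable, with a constant that takes care of small
numbers of agents. -/
theorem exists_isFractionalCoreStable : ∃ c : ℝ, 0 < c ∧ ∀ (n : ℕ) (G : SimpleFHG n)
    (π : Finpartition (Finset.univ : Finset (Fin n))),
    (2 ≤ cbrt n → ∃ H : Finset (Fin n), cbrt n / 128 ≤ H.card ∧
      ∀ i ∈ H, G.Content (cbrt n) (π.part i) i) →
    ∀ ε : ℝ, (2 : ℝ) ^ (-(c * (n : ℝ) ^ ((1 : ℝ) / 3))) ≤ ε → G.IsFractionalCoreStable ε π := by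
  obtain ⟨q₀, hq₀, hbound⟩ := eventually_bound_lt
  -- Up to `N` agents, use that a coalition with one member does not block.
  set N := q₀ ^ 3 with hN
  set c₂ : ℝ := (1 / 2) ^ N / (2 * (N + 1)) with hc₂
  have hc₂pos : 0 < c₂ := by positivity
  refine ⟨min (1 / 256) c₂, lt_min (by norm_num) hc₂pos, fun n G π hπ ε hε => ?_⟩
  refine lt_of_lt_of_le ?_ hε
  set c := min (1 / 256) c₂
  have hcpos : 0 < c := lt_min (by norm_num) hc₂pos
  have hroot0 : 0 ≤ (n : ℝ) ^ ((1 : ℝ) / 3) := by positivity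
  rcases Nat.eq_zero_or_pos n with rfl | hn
  · rw [ncard_nonempty]
    simp only [pow_zero, sub_self, div_zero]
    positivity
  by_cases hq : q₀ ≤ cbrt n
  · obtain ⟨H, hk, hH⟩ := hπ (hq₀.trans hq)
    have hblock := ncard_coreBlocks_le hk hH
    have hup := lt_cbrt_add_one_pow n
    set q := cbrt n
    have hq2 : (2 : ℝ) ≤ q := by exact_mod_cast hq₀.trans hq
    have hn' : (1 : ℝ) ≤ n := by exact_mod_cast hn
    have hup' : (n : ℝ) ≤ (q + 1) ^ 3 := by exact_mod_cast hup.le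
    have hroot : (n : ℝ) ^ ((1 : ℝ) / 3) ≤ q + 1 := by
      calc (n : ℝ) ^ ((1 : ℝ) / 3) ≤ ((q + 1 : ℝ) ^ 3) ^ ((1 : ℝ) / 3) := by gcongr
        _ = q + 1 := by
          rw [← Real.rpow_natCast, ← Real.rpow_mul (by positivity)]
          norm_num
    have hexp : Real.exp (-((q : ℝ) ^ 4 / (2 * n))) ≤ Real.exp (-(q / 16)) := by
      refine Real.exp_le_exp.2 (neg_le_neg ?_)
      rw [div_le_div_iff₀ (by norm_num) (by positivity)]
      have : (q + 1 : ℝ) ^ 3 ≤ (2 * q) ^ 3 := by gcongr; linarith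
      nlinarith
    have htwo : (2 : ℝ) ≤ 2 ^ n := by
      simpa using pow_le_pow_right₀ (by norm_num : (1 : ℝ) ≤ 2) hn
    set X : ℝ := ((q + 1 : ℝ) ^ 3 + 2) * Real.exp (-(q / 16)) + (1 / 2 : ℝ) ^ (q / 128) with hX
    have hXpos : 0 < X := by positivity
    have hle : (({S | G.CoreBlocks π S} : Set (Finset (Fin n))).ncard : ℝ) ≤ 2 ^ n * X := by
      refine hblock.trans ?_
      rw [hX]
      gcongr
    rw [ncard_nonempty]
    calc _ ≤ 2 * X := by
          rw [div_le_iff₀ (by linarith)]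
          nlinarith
      _ < (2 : ℝ) ^ (-((q + 1 : ℝ) / 256)) := hbound q hq
      _ ≤ _ := by
        refine Real.rpow_le_rpow_of_exponent_le (by norm_num) (neg_le_neg ?_)
        calc c * (n : ℝ) ^ ((1 : ℝ) / 3) ≤ 1 / 256 * (q + 1) :=
              mul_le_mul (min_le_left _ _) hroot hroot0 (by norm_num)
          _ = (q + 1 : ℝ) / 256 := by ring
  · have hnN : n ≤ N :=
      (lt_cbrt_add_one_pow n).le.trans (Nat.pow_le_pow_left (by omega : cbrt n + 1 ≤ q₀) 3)
    refine (coreBlocks_fraction_le hn π).trans_lt ?_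
    have h1 : (1 / 2 : ℝ) ^ N ≤ (1 / 2) ^ n :=
      pow_le_pow_of_le_one (by norm_num) (by norm_num) hnN
    have hroot : (n : ℝ) ^ ((1 : ℝ) / 3) ≤ N + 1 := by
      have hn1 : (1 : ℝ) ≤ n := by exact_mod_cast hn
      have hnN' : (n : ℝ) ≤ N := by exact_mod_cast hnN
      have := Real.rpow_le_rpow_of_exponent_le hn1 (by norm_num : (1 : ℝ) / 3 ≤ 1)
      rw [Real.rpow_one] at this
      linarith
    have h2 : c * (n : ℝ) ^ ((1 : ℝ) / 3) ≤ (1 / 2) ^ N / 2 := by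
      calc c * (n : ℝ) ^ ((1 : ℝ) / 3) ≤ c₂ * (N + 1) :=
            mul_le_mul (min_le_right _ _) hroot hroot0 hc₂pos.le
        _ = (1 / 2) ^ N / 2 := by
          rw [hc₂]
          field_simp
    have h3 : 1 - c * (n : ℝ) ^ ((1 : ℝ) / 3) ≤ (2 : ℝ) ^ (-(c * (n : ℝ) ^ ((1 : ℝ) / 3))) := by
      have hx : 0 ≤ c * (n : ℝ) ^ ((1 : ℝ) / 3) := mul_nonneg hcpos.le hroot0
      rw [Real.rpow_def_of_pos (x := 2) (by norm_num)]
      have := Real.add_one_le_exp (Real.log 2 * -(c * (n : ℝ) ^ ((1 : ℝ) / 3)))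
      have hl := Real.log_two_lt_d9
      nlinarith
    have h4 : (0 : ℝ) < (1 / 2) ^ N := by positivity
    linarith

end SimpleFHG

/-- There are a learning program and a computation program, both running in polynomial time, and a
constant `c > 0` such that: on a known game the computation program returns a partition that is
`ε`-fractional core-stable for every `ε ≥ 2 ^ (-c n^{1/3})`; and from any number `m` of
uniform samples above a polynomial in `n` and `log (1/δ)`, the two programs always halt in time, and
with probability at least `1 - δ` they learn the game exactly and return such a partition. -/
theorem mainTheorem1 :
    ∃ (learn compute : RAM.Program) (sampleBound learnTime computeTime : Polynomial ℕ) (c : ℝ),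
      0 < c ∧
      (∀ (n : ℕ) (G : SimpleFHG n), ∃ π : Finpartition (Finset.univ : Finset (Fin n)),
        SimpleFHG.ComputesWithin compute (computeTime.eval n) G π ∧
        ∀ ε : ℝ, (2 : ℝ) ^ (-(c * (n : ℝ) ^ ((1 : ℝ) / 3))) ≤ ε →
          G.IsFractionalCoreStable ε π) ∧
      (∀ (n m : ℕ) (δ : ℝ) (G : SimpleFHG n), 0 < δ → δ < 1 →
        Polynomial.aeval ((n : ℝ) + Real.log (1 / δ)) sampleBound ≤ (m : ℝ) →
        (∀ S : Fin m → Finset (Fin n), ∃ (G' : SimpleFHG n)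
            (π : Finpartition (Finset.univ : Finset (Fin n))),
          SimpleFHG.LearnsWithin learn (learnTime.eval (n + m)) G S G' ∧
          SimpleFHG.ComputesWithin compute (computeTime.eval n) G' π) ∧
        ENNReal.ofReal (1 - δ) ≤ (uniformSamples n m).toOuterMeasure
          {S : Fin m → Finset (Fin n) | ∃ (G' : SimpleFHG n)
              (π : Finpartition (Finset.univ : Finset (Fin n))),
            SimpleFHG.LearnsWithin learn (learnTime.eval (n + m)) G S G' ∧
            SimpleFHG.ComputesWithin compute (computeTime.eval n) G' π ∧
            G' = G ∧
            ∀ ε : ℝ, (2 : ℝ) ^ (-(c * (n : ℝ) ^ ((1 : ℝ) / 3))) ≤ ε →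
              G.IsFractionalCoreStable ε π}) := by
  obtain ⟨c, hc, hstable⟩ := SimpleFHG.exists_isFractionalCoreStable
  refine ⟨learnProgram, PartitionProgram.program, 2048 * Polynomial.X ^ 3,
    RAM.tabulateCost (.ite learnTerm (.const 1) (.const 0)),
    RAM.tabulateAllCost PartitionProgram.stages, c, hc, fun n G => ?_, ?_⟩
  · obtain ⟨π, hrun, hcontent⟩ := PartitionProgram.exists_computesWithin G
    exact ⟨π, hrun, hstable n G π hcontent⟩
  · intro n m δ G h0 h1 hm
    refine ⟨fun S => ?_, ?_⟩
    · obtain ⟨π, hrun, -⟩ := PartitionProgram.exists_computesWithin (G.learnedGame S)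
      exact ⟨G.learnedGame S, π, G.learnsWithin_learnedGame S, hrun⟩
    · have hm' : 2048 * ((n : ℝ) + Real.log (1 / δ)) ^ 3 ≤ m := by
        simpa only [map_mul, map_pow, Polynomial.aeval_X, map_ofNat] using hm
      refine (G.le_uniformSamples_learnedGame_eq h0 h1 hm').trans
        ((uniformSamples n m).toOuterMeasure.mono fun S hS => ?_)
      obtain ⟨π, hrun, hcontent⟩ := PartitionProgram.exists_computesWithin G
      have hlearn := G.learnsWithin_learnedGame S
      rw [show G.learnedGame S = G from hS] at hlearn
      exact ⟨G, π, hlearn, hrun, rfl, hstable n G π hcontent⟩
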